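/- Let $d\ge 1$ and $n\ge 2$, and let $\Phi:\mathbb{R}^d\to\mathbb{R}$ be a positive definite function defining the translation-invariant kernel $(u,v)\mapsto\Phi(u-v)$; that is, $\Phi$ is continuous and even, and $\sum_{j,k}\alpha_j\alpha_k\Phi(y_j-y_k)>0$ for all finitely many pairwise distinct points $y_j\in\mathbb{R}^d$ and all real coefficient vectors $\alpha\neq 0$. Suppose that $\Phi\in L_1(\mathbb{R}^d)$ and that its Fourier transform $$\hat\Phi(\omega)=(2\pi)^{-d/2}\int_{\mathbb{R}^d}\Phi(x)\,e^{-i\omega'x}\,dx$$ (which is real, since $\Phi$ is even) belongs to $L_1(\mathbb{R}^d)$. For $M>0$ let $\hat\Phi_*(M)=\inf_{\|\omega\|_2\le 2M}\hat\Phi(\omega)$, let $\chi_M$ be the indicator function of $\{\omega\in\mathbb{R}^d:\|\omega\|_2\le M\}$, and let $\Upsilon_M(t)=(2\pi)^{-d/2}\int_{\mathbb{R}^d}\hat\Upsilon_M(\omega)e^{i\omega't}\,d\omega$ be the inverse Fourier transform of $$\hat\Upsilon_M(\omega)=\frac{\hat\Phi_*(M)\,\Gamma(d/2+1)}{2^dM^d\pi^{d/2}}\,(\chi_M*\chi_M)(\omega),\qquad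 (f*g)(\omega)=\int_{\mathbb{R}^d}f(y)\,g(\omega-y)\,dy .$$ Let $\Theta$ be a non-singular real $d\times d$ matrix and $d_\Theta(u,v)=\|\Theta(u-v)\|_2$. Let $x_1,\dots,x_n\in\mathbb{R}^d$ be pairwise distinct, with local and global separation distances $$q_j(\Theta)=\tfrac12\min_{k\ne j}d_\Theta(x_j,x_k),\qquad q(\Theta)=\min_j q_j(\Theta),$$ and let $c_*>0$. Then: 1. For every $M>0$, $$\Upsilon_M(0):=\lim_{t\to 0}\Upsilon_M(t)=\frac{\hat\Phi_*(M)}{\Gamma(d/2+1)}\Bigl(\frac{M}{2^{3/2}}\Bigr)^d .$$ 2. For every $\alpha\in\mathbb{R}^n$, $$\sum_{j=1}^n\sum_{k=1}^n\alpha_j\alpha_k\,\Phi\bigl(\Theta(x_j-x_k)\bigr)\;\ge\;\Upsilon_{c_*/q(\Theta)}(0)\sum_{j=1}^n\alpha_j^2\left(1-\frac{\Gamma^2(d/2+1)\,\pi}{18}\cdot\frac{q(\Theta)}{q_j(\Theta)}\Bigl(\frac{12}{c_*}\Bigr)^{d+1}\right).$$ 3. Consequently the smallest eigenvalue of the symmetric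 matrix $K=\bigl(\Phi(\Theta(x_j-x_k))\bigr)_{j,k=1}^n$ satisfies $$\lambda_{\min}(K)\;\ge\;\min_{1\le j\le n}\Upsilon_{c_*/q(\Theta)}(0)\left(1-\frac{\Gamma^2(d/2+1)\,\pi}{18}\cdot\frac{q(\Theta)}{q_j(\Theta)}\Bigl(\frac{12}{c_*}\Bigr)^{d+1}\right).$$ -/

import Mathlib

open MeasureTheory Filter
open scoped Topology RealInnerProductSpace Convolution

noncomputable section

/-- `ℝ^d` with the Euclidean norm and Lebesgue measure. -/
abbrev Euc (d : ℕ) : Type := EuclideanSpace ℝ (Fin d)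

/-- A positive definite, translation invariant kernel `(u, v) ↦ Φ (u - v)` on `ℝ^d`: a continuous,
even, real function all of whose quadratic forms at finitely many pairwise distinct points are
strictly positive away from the zero coefficient vector. -/
structure IsPosDefKernel {d : ℕ} (Φ : Euc d → ℝ) : Prop where
  continuous : Continuous Φ
  even : ∀ x, Φ (-x) = Φ x
  pos : ∀ (n : ℕ) (x : Fin n → Euc d), Function.Injective x → ∀ α : Fin n → ℝ, α ≠ 0 →
    0 < ∑ j, ∑ k, α j * α k * Φ (x j - x k)

/-- The Fourier transform `(2π)^(-d/2) ∫ f(x) exp(-i ω'x) dx`. -/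
def fourierHat {d : ℕ} (f : Euc d → ℝ) (ω : Euc d) : ℂ :=
  (((2 * Real.pi) ^ (-(d : ℝ) / 2) : ℝ) : ℂ) *
    ∫ x, (f x : ℂ) * Complex.exp (-(Complex.I * ((⟪ω, x⟫ : ℝ) : ℂ)))

/-- The inverse Fourier transform `(2π)^(-d/2) ∫ g(ω) exp(i ω't) dω`. -/
def fourierCheck {d : ℕ} (g : Euc d → ℝ) (t : Euc d) : ℂ :=
  (((2 * Real.pi) ^ (-(d : ℝ) / 2) : ℝ) : ℂ) *
    ∫ ω, (g ω : ℂ) * Complex.exp (Complex.I * ((⟪ω, t⟫ : ℝ) : ℂ))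

/-- The Fourier transform of an even real function is real, so that taking real parts in
`fourierHatInf` below loses nothing. -/
theorem fourierHat_im_eq_zero {d : ℕ} {f : Euc d → ℝ} (hf : ∀ x, f (-x) = f x) (ω : Euc d) :
    (fourierHat f ω).im = 0 := by
  rw [← Complex.conj_eq_iff_im]
  unfold fourierHat
  rw [map_mul, Complex.conj_ofReal, ← integral_conj]
  congr 1
  rw [← integral_neg_eq_self]
  refine integral_congr_ae (Eventually.of_forall fun x => ?_)
  simp [← Complex.exp_conj, hf]

/-- The infimum of the Fourier transform of `Φ` over the closed ball of radius `2M`. -/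
def fourierHatInf {d : ℕ} (Φ : Euc d → ℝ) (M : ℝ) : ℝ :=
  sInf ((fun ω => (fourierHat Φ ω).re) '' {ω : Euc d | ‖ω‖ ≤ 2 * M})

/-- The indicator function of the closed ball of radius `M` about the origin. -/
def ballIndicator (d : ℕ) (M : ℝ) : Euc d → ℝ :=
  {ω : Euc d | ‖ω‖ ≤ M}.indicator 1

/-- The Fourier transform of `Υ_M`: an explicit multiple of the convolution `χ_M * χ_M`. -/
def upsilonHat {d : ℕ} (Φ : Euc d → ℝ) (M : ℝ) (ω : Euc d) : ℝ :=
  fourierHatInf Φ M * Real.Gamma ((d : ℝ) / 2 + 1) /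
      ((2 : ℝ) ^ d * M ^ d * Real.pi ^ ((d : ℝ) / 2)) *
    (ballIndicator d M ⋆[ContinuousLinearMap.mul ℝ ℝ, volume] ballIndicator d M) ω

/-- The function `Υ_M`, the inverse Fourier transform of `upsilonHat Φ M`. -/
def upsilon {d : ℕ} (Φ : Euc d → ℝ) (M : ℝ) (t : Euc d) : ℂ :=
  fourierCheck (upsilonHat Φ M) t

/-- The number `Υ_M(0)` in closed form. -/
def upsilonZero {d : ℕ} (Φ : Euc d → ℝ) (M : ℝ) : ℝ :=
  fourierHatInf Φ M / Real.Gamma ((d : ℝ) / 2 + 1) * (M / (2 : ℝ) ^ (3 / 2 : ℝ)) ^ d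

/-- The Mahalanobis-like distance `‖Θ (u - v)‖₂`. -/
def mahalanobisDist {d : ℕ} (Θ : Matrix (Fin d) (Fin d) ℝ) (u v : Euc d) : ℝ :=
  ‖Matrix.toEuclideanLin Θ (u - v)‖

/-- The local separation distance `q_j(Θ)`: half the minimal distance from `x j` to another point
(a minimum over a nonempty finite set when there are at least two points). -/
def localSep {d n : ℕ} (Θ : Matrix (Fin d) (Fin d) ℝ) (x : Fin n → Euc d) (j : Fin n) : ℝ :=
  1 / 2 * ⨅ k : {k : Fin n // k ≠ j}, mahalanobisDist Θ (x j) (x k)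

/-- The global separation distance `q(Θ)`, the minimum of the local ones. -/
def globalSep {d n : ℕ} (Θ : Matrix (Fin d) (Fin d) ℝ) (x : Fin n → Euc d) : ℝ :=
  ⨅ j, localSep Θ x j

/-- The factor multiplying `Υ_{c/q(Θ)}(0) α_j²` in the lower bound. -/
def sepFactor {d n : ℕ} (Θ : Matrix (Fin d) (Fin d) ℝ) (x : Fin n → Euc d) (c : ℝ)
    (j : Fin n) : ℝ :=
  1 - Real.Gamma ((d : ℝ) / 2 + 1) ^ 2 * Real.pi / 18 *
    (globalSep Θ x / localSep Θ x j) * (12 / c) ^ (d + 1)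

/-- The kernel matrix `(Φ (Θ (x_j - x_k)))_{j,k}`. -/
def kernelMatrix {d n : ℕ} (Φ : Euc d → ℝ) (Θ : Matrix (Fin d) (Fin d) ℝ)
    (x : Fin n → Euc d) : Matrix (Fin n) (Fin n) ℝ :=
  Matrix.of fun j k => Φ (Matrix.toEuclideanLin Θ (x j - x k))

end

/-! The kernel is compared with a minorant whose Fourier transform is compactly supported. A
positive definite integrable `Φ` has a nonnegative Fourier transform
(`IsPosDefKernel.integral_mul_cos_nonneg`). The convolution `χ_M * χ_M` lives in the ball of radius
`2M` and is at most the volume of the `M`-ball, so its multiple `upsilonHat` stays below the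
transform of `Φ` everywhere. By Fourier inversion both quadratic forms are integrals of these
transforms against `|∑ α_j exp(iω'y_j)|²`, so the form of `Φ` dominates that of `Υ_M`
(`IsPosDefKernel.sum_sum_upsilon_le`).

The transform of a convolution square is a square, so `Υ_M(t)/Υ_M(0)` is the square of the
normalized Fourier integral of the ball at `Mt` (`upsilon_eq`). It equals 1 at the origin and decays
like `‖Mt‖^(-(d+1))` with an explicit constant (`norm_ballTransform_sq_le`). This Bessel-type bound
comes from slicing the ball into Poisson's integral and shifting the contour.

With `M = c/q`, a packing argument sums the decay over the points other than `x_j`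
(`sum_inv_norm_sub_pow_le`); the local separation enters through the radius around `x_j` that is
free of other points. Diagonal dominance gives the quadratic bound, and a unit eigenvector gives the
eigenvalue bound. -/

/-! ### Lower bounds for the Gamma function. -/

/-- Euler's integral is cut down to `(T, ∞)`, where `x^s ≥ T^s`. -/
theorem Real.rpow_mul_exp_neg_le_Gamma {s T : ℝ} (hs : 0 ≤ s) (hT : 0 < T) :
    T ^ s * Real.exp (-T) ≤ Real.Gamma (s + 1) := by
  have hint := Real.GammaIntegral_convergent (s := s + 1) (by linarith)
  rw [Real.Gamma_eq_integral (by linarith)]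
  calc T ^ s * Real.exp (-T) = ∫ x in Set.Ioi T, Real.exp (-x) * T ^ s := by
        rw [integral_mul_const, integral_exp_neg_Ioi, mul_comm]
    _ ≤ ∫ x in Set.Ioi T, Real.exp (-x) * x ^ (s + 1 - 1) := by
        refine setIntegral_mono_on ((integrableOn_exp_neg_Ioi T).mul_const _)
          (hint.mono_set (Set.Ioi_subset_Ioi hT.le)) measurableSet_Ioi fun x hx => ?_
        have : T ≤ x := le_of_lt hx
        simp only [add_sub_cancel_right]
        gcongr
    _ ≤ _ := by
        refine setIntegral_mono_set hint ?_ (Set.Ioi_subset_Ioi hT.le).eventuallyLE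
        filter_upwards [ae_restrict_mem measurableSet_Ioi] with x hx
        have : 0 ≤ x := le_of_lt hx
        simp only [Pi.zero_apply]
        positivity

/-- For arguments up to `d/2` this makes the claimed decay bound for the ball weaker than the
trivial one. The previous bound at `s = T = d/2` gives `Γ² ≥ (d/(2e))^d`. The number 1.4 satisfies
both `1.4/4 ≤ 1/e` and, via Bernoulli, `1.4^d ≥ 1 + 0.4 d ≥ π d/8`. -/
theorem Real.pi_mul_div_pow_le_Gamma_sq {d : ℕ} (hd : 0 < d) {z : ℝ} (hz : 0 ≤ z)
    (hzd : z ≤ d / 2) :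
    Real.pi * (z / 4) ^ (d + 1) ≤ Real.Gamma ((d : ℝ) / 2 + 1) ^ 2 := by
  have hd' : (0 : ℝ) < d := by exact_mod_cast hd
  have h1 := Real.rpow_mul_exp_neg_le_Gamma (s := (d : ℝ) / 2) (T := (d : ℝ) / 2)
    (by positivity) (by positivity)
  have h2 : (((d : ℝ) / 2) ^ ((d : ℝ) / 2) * Real.exp (-((d : ℝ) / 2))) ^ 2
      = ((d : ℝ) / 2 * Real.exp (-1)) ^ d := by
    rw [mul_pow, mul_pow, ← Real.rpow_natCast (((d : ℝ) / 2) ^ ((d : ℝ) / 2)),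
      ← Real.rpow_mul (by positivity), ← Real.exp_nat_mul, ← Real.exp_nat_mul,
      ← Real.rpow_natCast]
    congr 2
    · push_cast; ring
    · push_cast; ring
  have h3 : (1.4 : ℝ) / 4 ≤ Real.exp (-1) := by
    rw [Real.exp_neg, div_le_iff₀ (by norm_num), inv_mul_eq_div, le_div_iff₀ (Real.exp_pos 1)]
    linarith [Real.exp_one_lt_d9]
  have h4 : 1 + (d : ℝ) * 0.4 ≤ (1.4 : ℝ) ^ d := by
    have := one_add_mul_le_pow (a := (0.4 : ℝ)) (by norm_num) d
    norm_num at this ⊢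
    linarith
  calc Real.pi * (z / 4) ^ (d + 1) ≤ Real.pi * ((d : ℝ) / 2 / 4) ^ (d + 1) := by gcongr
    _ = (Real.pi * ((d : ℝ) / 8)) * ((d : ℝ) / 8) ^ d := by rw [pow_succ]; ring_nf
    _ ≤ 1.4 ^ d * ((d : ℝ) / 8) ^ d := by
        gcongr
        nlinarith [Real.pi_lt_d2]
    _ = ((d : ℝ) / 2 * (1.4 / 4)) ^ d := by rw [← mul_pow]; ring_nf
    _ ≤ ((d : ℝ) / 2 * Real.exp (-1)) ^ d := by gcongr
    _ ≤ _ := by rw [← h2]; gcongr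

/-! ### Decay of Poisson's integral by contour shift. -/

section Contour

open Complex

/-- The holomorphic extension `(1 - u) ^ p * (1 + u) ^ p * exp (i z u)` of the integrand in
Poisson's integral for the Bessel functions. -/
noncomputable def poissonIntegrand (p z : ℝ) (u : ℂ) : ℂ :=
  (1 - u) ^ (p : ℂ) * (1 + u) ^ (p : ℂ) * cexp (I * (z * u))

theorem norm_poissonIntegrand (p z x y : ℝ) :
    ‖poissonIntegrand p z (x + y * I)‖ =
      (‖(1 - x : ℂ) - y * I‖ * ‖(1 + x : ℂ) + y * I‖) ^ p * Real.exp (-(z * y)) := by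
  rw [poissonIntegrand, norm_mul, norm_mul, norm_cpow_real, norm_cpow_real, Complex.norm_exp,
    Real.mul_rpow (norm_nonneg _) (norm_nonneg _)]
  congr 3
  · ring_nf
  · ring_nf
  · simp

theorem poissonIntegrand_ofReal (p z : ℝ) {s : ℝ} (hs : s ∈ Set.Icc (-1 : ℝ) 1) :
    poissonIntegrand p z s = (((1 - s ^ 2) ^ p : ℝ) : ℂ) * cexp (I * (z * s)) := by
  have h1 : 0 ≤ 1 - s := by linarith [hs.2]
  have h2 : 0 ≤ 1 + s := by linarith [hs.1]
  have h3 : 1 - s ^ 2 = (1 - s) * (1 + s) := by ring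
  rw [poissonIntegrand, h3, Real.mul_rpow h1 h2]
  push_cast [ofReal_cpow h1, ofReal_cpow h2]
  rfl

theorem continuousAt_poissonIntegrand {p : ℝ} (hp : 0 ≤ p) (z : ℝ) {u : ℂ}
    (h1 : u.re ≤ 1) (h2 : -1 ≤ u.re) : ContinuousAt (poissonIntegrand p z) u := by
  unfold poissonIntegrand
  refine ContinuousAt.mul ?_ (by fun_prop)
  -- At the branch points `±1` the power is continuous for positive exponent; exponent zero gives
  -- the constant 1.
  rcases hp.eq_or_lt with rfl | hp
  · simp only [ofReal_zero, cpow_zero, mul_one]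
    fun_prop
  refine ContinuousAt.mul ?_ ?_
  · exact ContinuousAt.comp (f := fun u : ℂ => 1 - u)
      (continuousAt_cpow_const_of_re_pos (Or.inl (by simpa using h1)) (by simpa using hp))
      (by fun_prop)
  · exact ContinuousAt.comp (f := fun u : ℂ => 1 + u)
      (continuousAt_cpow_const_of_re_pos (Or.inl (by simp; linarith)) (by simpa using hp))
      (by fun_prop)

theorem differentiableAt_poissonIntegrand (p z : ℝ) {u : ℂ}
    (h1 : u.re < 1) (h2 : -1 < u.re) : DifferentiableAt ℂ (poissonIntegrand p z) u := by
  unfold poissonIntegrand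
  refine DifferentiableAt.mul (DifferentiableAt.mul ?_ ?_) (by fun_prop)
  · exact DifferentiableAt.cpow (by fun_prop) (by fun_prop) (Or.inl (by simpa using h1))
  · exact DifferentiableAt.cpow (by fun_prop) (by fun_prop) (Or.inl (by simp; linarith))

theorem rpow_mul_exp_neg_integral {p z : ℝ} (hp : 0 ≤ p) (hz : 0 < z) :
    ∫ y in Set.Ioi (0 : ℝ), 2 ^ p * (y ^ p * Real.exp (-(z / 2 * y))) =
      2 ^ p * ((2 / z) ^ (p + 1) * Real.Gamma (p + 1)) := by
  have := Real.integral_rpow_mul_exp_neg_mul_Ioi (a := p + 1) (r := z / 2) (by linarith)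
    (by linarith)
  simp only [add_sub_cancel_right, one_div, inv_div] at this
  rw [integral_const_mul, this]

theorem integrableOn_rpow_mul_exp_neg {p z : ℝ} (hp : 0 ≤ p) (hz : 0 < z) :
    IntegrableOn (fun y : ℝ => 2 ^ p * (y ^ p * Real.exp (-(z / 2 * y)))) (Set.Ioi 0) := by
  have := integrableOn_rpow_mul_exp_neg_mul_rpow (p := 1) (s := p) (b := z / 2) (by linarith)
    (by norm_num) (by linarith)
  simp only [Real.rpow_one, neg_mul] at this
  exact this.const_mul _

/-- On the lines `Re u = ±1` one factor has modulus `y` and the other at most `2 + y ≤ 2 exp(y/2)`.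
Its power costs `exp(py/2)`, and `p ≤ z` leaves half of the decay `exp(-zy)`, hence a Gamma integral
with rate `z/2`. -/
theorem norm_intervalIntegral_poissonIntegrand_vertical_le {p z : ℝ} (hp : 0 ≤ p) (hz : 0 < z)
    (hpz : p ≤ z) {Y : ℝ} (hY : 0 ≤ Y) {x : ℝ} (hx : x = 1 ∨ x = -1) :
    ‖∫ y in (0 : ℝ)..Y, poissonIntegrand p z (x + y * I)‖ ≤
      2 ^ p * ((2 / z) ^ (p + 1) * Real.Gamma (p + 1)) := by
  have key : ∀ y : ℝ, 0 ≤ y → ‖poissonIntegrand p z (x + y * I)‖ ≤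
      2 ^ p * (y ^ p * Real.exp (-(z / 2 * y))) := by
    intro y hy
    have h2 : ‖(2 : ℂ) + y * I‖ ≤ 2 * Real.exp (y / 2) := by
      calc ‖(2 : ℂ) + y * I‖ ≤ ‖(2 : ℂ)‖ + ‖(y * I : ℂ)‖ := norm_add_le _ _
        _ = 2 + y := by simp [abs_of_nonneg hy]
        _ ≤ _ := by linarith [Real.add_one_le_exp (y / 2)]
    have h2' : ‖(2 : ℂ) - y * I‖ ≤ 2 * Real.exp (y / 2) := by
      calc ‖(2 : ℂ) - y * I‖ ≤ ‖(2 : ℂ)‖ + ‖(y * I : ℂ)‖ := norm_sub_le _ _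
        _ = 2 + y := by simp [abs_of_nonneg hy]
        _ ≤ _ := by linarith [Real.add_one_le_exp (y / 2)]
    have h3 : ‖(1 - x : ℂ) - y * I‖ * ‖(1 + x : ℂ) + y * I‖ ≤ y * (2 * Real.exp (y / 2)) := by
      rcases hx with rfl | rfl
      · have e1 : (1 - (1 : ℝ) : ℂ) - y * I = -(y * I) := by push_cast; ring
        have e2 : (1 + (1 : ℝ) : ℂ) + y * I = 2 + y * I := by push_cast; ring
        rw [e1, e2, norm_neg]
        have : ‖(y * I : ℂ)‖ = y := by simp [abs_of_nonneg hy]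
        rw [this]
        gcongr
      · have e1 : (1 - ((-1 : ℝ) : ℝ) : ℂ) - y * I = 2 - y * I := by push_cast; ring
        have e2 : (1 + ((-1 : ℝ) : ℝ) : ℂ) + y * I = y * I := by push_cast; ring
        rw [e1, e2, mul_comm]
        have : ‖(y * I : ℂ)‖ = y := by simp [abs_of_nonneg hy]
        rw [this]
        gcongr
    rw [norm_poissonIntegrand]
    calc _ ≤ (y * (2 * Real.exp (y / 2))) ^ p * Real.exp (-(z * y)) := by gcongr
      _ = 2 ^ p * (y ^ p * (Real.exp (y / 2 * p) * Real.exp (-(z * y)))) := by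
        rw [Real.mul_rpow hy (by positivity), Real.mul_rpow (by norm_num) (by positivity),
          ← Real.exp_mul]
        ring
      _ ≤ _ := by
        rw [← Real.exp_add]
        gcongr
        nlinarith
  calc _ ≤ ∫ y in (0 : ℝ)..Y, 2 ^ p * (y ^ p * Real.exp (-(z / 2 * y))) := by
        refine intervalIntegral.norm_integral_le_of_norm_le hY ?_ ?_
        · exact Eventually.of_forall fun y hy => key y hy.1.le
        · rw [intervalIntegrable_iff_integrableOn_Ioc_of_le hY]
          exact (integrableOn_rpow_mul_exp_neg hp hz).mono_set Set.Ioc_subset_Ioi_self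
    _ ≤ ∫ y in Set.Ioi (0 : ℝ), 2 ^ p * (y ^ p * Real.exp (-(z / 2 * y))) := by
        rw [intervalIntegral.integral_of_le hY]
        refine setIntegral_mono_set (integrableOn_rpow_mul_exp_neg hp hz) ?_
          Set.Ioc_subset_Ioi_self.eventuallyLE
        filter_upwards [ae_restrict_mem measurableSet_Ioi] with y hy
        have : 0 ≤ y := le_of_lt hy
        simp only [Pi.zero_apply]
        positivity
    _ = _ := rpow_mul_exp_neg_integral hp hz

theorem norm_intervalIntegral_poissonIntegrand_horizontal_le {p z : ℝ} (hp : 0 ≤ p)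
    (hpz : p ≤ z) {Y : ℝ} (hY : 0 ≤ Y) :
    ‖∫ x in (-1 : ℝ)..1, poissonIntegrand p z (x + Y * I)‖ ≤
      16 ^ p * Real.exp (-(z / 2 * Y)) * 2 := by
  have key : ∀ x ∈ Set.uIoc (-1 : ℝ) 1, ‖poissonIntegrand p z (x + Y * I)‖ ≤
      16 ^ p * Real.exp (-(z / 2 * Y)) := by
    intro x hx
    rw [Set.uIoc_of_le (by norm_num)] at hx
    have hx1 : |1 - x| ≤ 2 := abs_le.2 ⟨by linarith [hx.2], by linarith [hx.1]⟩
    have hx2 : |1 + x| ≤ 2 := abs_le.2 ⟨by linarith [hx.1], by linarith [hx.2]⟩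
    have hexp : 2 + Y ≤ 4 * Real.exp (Y / 4) := by linarith [Real.add_one_le_exp (Y / 4)]
    have h1 : ‖(1 - x : ℂ) - Y * I‖ ≤ 4 * Real.exp (Y / 4) := by
      have : ‖(1 - x : ℂ)‖ = |1 - x| := by
        rw [← ofReal_one, ← ofReal_sub, norm_real, Real.norm_eq_abs]
      calc ‖(1 - x : ℂ) - Y * I‖ ≤ ‖(1 - x : ℂ)‖ + ‖(Y * I : ℂ)‖ := norm_sub_le _ _
        _ ≤ 2 + Y := by rw [this]; simp [abs_of_nonneg hY, hx1]
        _ ≤ _ := hexp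
    have h2 : ‖(1 + x : ℂ) + Y * I‖ ≤ 4 * Real.exp (Y / 4) := by
      have : ‖(1 + x : ℂ)‖ = |1 + x| := by
        rw [← ofReal_one, ← ofReal_add, norm_real, Real.norm_eq_abs]
      calc ‖(1 + x : ℂ) + Y * I‖ ≤ ‖(1 + x : ℂ)‖ + ‖(Y * I : ℂ)‖ := norm_add_le _ _
        _ ≤ 2 + Y := by rw [this]; simp [abs_of_nonneg hY, hx2]
        _ ≤ _ := hexp
    rw [norm_poissonIntegrand]
    calc _ ≤ ((4 * Real.exp (Y / 4)) * (4 * Real.exp (Y / 4))) ^ p * Real.exp (-(z * Y)) := by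
          gcongr
      _ = 16 ^ p * (Real.exp (Y / 2 * p) * Real.exp (-(z * Y))) := by
        have : (4 * Real.exp (Y / 4)) * (4 * Real.exp (Y / 4)) = 16 * Real.exp (Y / 2) := by
          rw [mul_mul_mul_comm, ← Real.exp_add]; ring_nf
        rw [this, Real.mul_rpow (by norm_num) (by positivity), ← Real.exp_mul]
        ring
      _ ≤ _ := by
        rw [← Real.exp_add]
        gcongr
        nlinarith
  refine (intervalIntegral.norm_integral_le_of_norm_le_const key).trans (le_of_eq ?_)
  norm_num

/-- The decay of Poisson's integral, by moving the contour to two vertical half-lines. -/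
theorem norm_integral_one_sub_sq_rpow_mul_cexp_le {p z : ℝ} (hp : 0 ≤ p) (hz : 0 < z)
    (hpz : p ≤ z) :
    ‖∫ s in (-1 : ℝ)..1, (((1 - s ^ 2) ^ p : ℝ) : ℂ) * cexp (I * (z * s))‖ ≤
      (4 / z) ^ (p + 1) * Real.Gamma (p + 1) := by
  have hbot : ∫ s in (-1 : ℝ)..1, (((1 - s ^ 2) ^ p : ℝ) : ℂ) * cexp (I * (z * s)) =
      ∫ s in (-1 : ℝ)..1, poissonIntegrand p z s := by
    refine intervalIntegral.integral_congr fun s hs => ?_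
    rw [Set.uIcc_of_le (by norm_num)] at hs
    exact (poissonIntegrand_ofReal p z hs).symm
  have key : ∀ Y : ℝ, 0 ≤ Y → ‖∫ s in (-1 : ℝ)..1, poissonIntegrand p z s‖ ≤
      (4 / z) ^ (p + 1) * Real.Gamma (p + 1) + 16 ^ p * Real.exp (-(z / 2 * Y)) * 2 := by
    intro Y hY
    -- Cauchy's theorem on `[-1,1] × [0,Y]`. The corners `±1` are branch points, so only continuity
    -- is available on the boundary, with holomorphy inside.
    have hrect := integral_boundary_rect_eq_zero_of_continuousOn_of_differentiableOn
      (poissonIntegrand p z) (-1 : ℝ) ((1 : ℝ) + Y * I) ?_ ?_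
    · simp only [ofReal_re, ofReal_im, add_re, mul_re, I_re, mul_zero, I_im, mul_one, sub_self,
        add_zero, add_im, mul_im, zero_add, ofReal_zero, zero_mul] at hrect
      have e : ∫ s in (-1 : ℝ)..1, poissonIntegrand p z s =
          (∫ x in (-1 : ℝ)..1, poissonIntegrand p z (x + Y * I)) -
          I • (∫ y in (0 : ℝ)..Y, poissonIntegrand p z ((1 : ℝ) + y * I)) +
          I • (∫ y in (0 : ℝ)..Y, poissonIntegrand p z ((-1 : ℝ) + y * I)) := by
        linear_combination hrect
      have hc : (4 / z) ^ (p + 1) * Real.Gamma (p + 1) =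
          2 * (2 ^ p * ((2 / z) ^ (p + 1) * Real.Gamma (p + 1))) := by
        have : 4 / z = 2 * (2 / z) := by ring
        rw [this, Real.mul_rpow (by norm_num) (by positivity), Real.rpow_add_one (by norm_num)]
        ring
      rw [e, hc]
      refine (norm_add_le _ _).trans ((add_le_add_left (norm_sub_le _ _) _).trans ?_)
      rw [norm_smul, norm_smul, norm_I, one_mul, one_mul]
      linarith [norm_intervalIntegral_poissonIntegrand_vertical_le hp hz hpz hY (Or.inl rfl),
        norm_intervalIntegral_poissonIntegrand_vertical_le hp hz hpz hY (Or.inr rfl),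
        norm_intervalIntegral_poissonIntegrand_horizontal_le hp hpz hY]
    · intro u hu
      rw [mem_reProdIm] at hu
      have := hu.1
      simp only [ofReal_re, add_re, mul_re, I_re, mul_zero, ofReal_im, I_im, sub_self, add_zero,
        Set.uIcc_of_le (show (-1 : ℝ) ≤ 1 by norm_num), mul_one] at this
      exact (continuousAt_poissonIntegrand hp z this.2 this.1).continuousWithinAt
    · intro u hu
      rw [mem_reProdIm] at hu
      have := hu.1
      simp only [ofReal_re, add_re, mul_re, I_re, mul_zero, ofReal_im, I_im, sub_self, add_zero,
        mul_one, min_eq_left (show (-1 : ℝ) ≤ 1 by norm_num),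
        max_eq_right (show (-1 : ℝ) ≤ 1 by norm_num)] at this
      exact (differentiableAt_poissonIntegrand p z this.2 this.1).differentiableWithinAt
  rw [hbot]
  -- As `Y → ∞` the top edge disappears and only the two vertical sides remain.
  have hlim : Tendsto (fun Y : ℝ => (4 / z) ^ (p + 1) * Real.Gamma (p + 1) +
      16 ^ p * Real.exp (-(z / 2 * Y)) * 2) atTop
      (𝓝 ((4 / z) ^ (p + 1) * Real.Gamma (p + 1) + 16 ^ p * 0 * 2)) := by
    refine tendsto_const_nhds.add ((Tendsto.const_mul _ ?_).mul_const _)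
    exact Real.tendsto_exp_neg_atTop_nhds_zero.comp
      (tendsto_id.const_mul_atTop (by positivity))
  rw [mul_zero, zero_mul, add_zero] at hlim
  exact ge_of_tendsto hlim (eventually_atTop.2 ⟨0, key⟩)

end Contour

/-! ### The Fourier integral of the unit ball. -/

section Slicing

open Complex

/-- The measurable equivalence `ℝ × ℝ^m ≃ ℝ^(m+1)` prepending a coordinate. -/
noncomputable def eucCons (m : ℕ) : ℝ × Euc m ≃ᵐ Euc (m + 1) :=
  ((MeasurableEquiv.refl ℝ).prodCongr (MeasurableEquiv.toLp 2 (Fin m → ℝ)).symm).trans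
    ((MeasurableEquiv.piFinSuccAbove (fun _ : Fin (m + 1) => ℝ) 0).symm.trans
      (MeasurableEquiv.toLp 2 (Fin (m + 1) → ℝ)))

theorem measurePreserving_eucCons (m : ℕ) : MeasurePreserving (eucCons m) := by
  have h1 : MeasurePreserving ((MeasurableEquiv.refl ℝ).prodCongr
      (MeasurableEquiv.toLp 2 (Fin m → ℝ)).symm) :=
    (MeasurePreserving.id volume).prod (PiLp.volume_preserving_ofLp (Fin m))
  have h2 := (volume_preserving_piFinSuccAbove (fun _ : Fin (m + 1) => ℝ) 0).symm
  exact (PiLp.volume_preserving_toLp (Fin (m + 1))).comp (h2.comp h1)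

@[simp]
theorem eucCons_apply_zero {m : ℕ} (p : ℝ × Euc m) : eucCons m p 0 = p.1 := by
  simp [eucCons]
  rfl

@[simp]
theorem eucCons_apply_succ {m : ℕ} (p : ℝ × Euc m) (i : Fin m) :
    eucCons m p i.succ = p.2 i := by
  simp [eucCons]
  rfl

theorem norm_sq_eucCons {m : ℕ} (p : ℝ × Euc m) :
    ‖eucCons m p‖ ^ 2 = p.1 ^ 2 + ‖p.2‖ ^ 2 := by
  simp [EuclideanSpace.norm_sq_eq, Fin.sum_univ_succ]

theorem norm_eucCons_le_one_iff {m : ℕ} (p : ℝ × Euc m) :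
    ‖eucCons m p‖ ≤ 1 ↔ p.1 ^ 2 + ‖p.2‖ ^ 2 ≤ 1 := by
  rw [← norm_sq_eucCons, sq_le_one_iff₀ (norm_nonneg _)]

/-- The Fourier integral of the indicator of the unit ball. -/
noncomputable def ballTransform {d : ℕ} (t : Euc d) : ℂ :=
  ∫ ω in Metric.closedBall (0 : Euc d) 1, cexp (I * ((⟪ω, t⟫ : ℝ) : ℂ))

theorem volume_real_closedBall_euc {m : ℕ} {r : ℝ} (hr : 0 ≤ r) :
    volume.real (Metric.closedBall (0 : Euc m) r) =
      r ^ m * volume.real (Metric.closedBall (0 : Euc m) 1) := by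
  rw [Measure.addHaar_real_closedBall _ _ hr, Measure.addHaar_real_closedBall _ _ zero_le_one]
  simp

/-- For a frequency along the first axis the character is constant on each slice, which is an
`m`-ball of radius `√(1 - s²)`; Fubini leaves Poisson's integral with exponent `m/2`. -/
theorem ballTransform_single {m : ℕ} (r : ℝ) :
    ballTransform (EuclideanSpace.single (0 : Fin (m + 1)) r) =
      volume.real (Metric.closedBall (0 : Euc m) 1) *
        ∫ s in (-1 : ℝ)..1, (((1 - s ^ 2) ^ ((m : ℝ) / 2) : ℝ) : ℂ) * cexp (I * (r * s)) := by
  classical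
  set V := volume.real (Metric.closedBall (0 : Euc m) 1)
  set G : Euc (m + 1) → ℂ := (Metric.closedBall (0 : Euc (m + 1)) 1).indicator
    fun ω => cexp (I * ((⟪ω, EuclideanSpace.single (0 : Fin (m + 1)) r⟫ : ℝ) : ℂ)) with hG
  have hGint : Integrable G := by
    rw [integrable_indicator_iff measurableSet_closedBall]
    exact ContinuousOn.integrableOn_compact (isCompact_closedBall _ _)
      (Continuous.continuousOn (by fun_prop))
  -- The guard is needed because `√` of a negative number is 0, and the closed ball of radius 0
  -- still contains the origin, which has mass 1 when `m = 0`.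
  have hGp : ∀ p : ℝ × Euc m, G (eucCons m p) =
      (Metric.closedBall (0 : Euc m) √(1 - p.1 ^ 2)).indicator
        (fun _ => if p.1 ^ 2 ≤ 1 then cexp (I * (r * p.1)) else 0) p.2 := by
    intro p
    simp only [hG, Set.indicator_apply, mem_closedBall_zero_iff, norm_eucCons_le_one_iff]
    by_cases h : p.1 ^ 2 ≤ 1
    · have : ‖p.2‖ ≤ √(1 - p.1 ^ 2) ↔ p.1 ^ 2 + ‖p.2‖ ^ 2 ≤ 1 := by
        rw [Real.le_sqrt (norm_nonneg _) (by linarith), le_sub_iff_add_le']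
      have hin : ⟪eucCons m p, EuclideanSpace.single (0 : Fin (m + 1)) r⟫ = r * p.1 := by
        rw [EuclideanSpace.inner_single_right]
        simp
      rw [hin]
      simp [this, h]
    · have : ¬ (p.1 ^ 2 + ‖p.2‖ ^ 2 ≤ 1) := fun h' => h (by nlinarith [sq_nonneg ‖p.2‖])
      simp [this, h]
  have hint : Integrable (fun p : ℝ × Euc m => G (eucCons m p)) :=
    ((measurePreserving_eucCons m).integrable_comp_emb
      (eucCons m).measurableEmbedding).2 hGint
  calc ballTransform (EuclideanSpace.single (0 : Fin (m + 1)) r) = ∫ ω, G ω := by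
        rw [ballTransform, hG, integral_indicator measurableSet_closedBall]
    _ = ∫ p : ℝ × Euc m, G (eucCons m p) :=
        ((measurePreserving_eucCons m).integral_comp (eucCons m).measurableEmbedding _).symm
    _ = ∫ s : ℝ, ∫ w : Euc m, G (eucCons m (s, w)) := integral_prod _ hint
    _ = ∫ s : ℝ, (Set.Icc (-1 : ℝ) 1).indicator (fun s : ℝ =>
          (V : ℂ) * ((((1 - s ^ 2) ^ ((m : ℝ) / 2) : ℝ) : ℂ) * cexp (I * (r * s)))) s := by
        refine integral_congr_ae (Eventually.of_forall fun s => ?_)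
        simp only [hGp]
        rw [integral_indicator measurableSet_closedBall, setIntegral_const,
          volume_real_closedBall_euc (Real.sqrt_nonneg _)]
        have hiff : s ∈ Set.Icc (-1 : ℝ) 1 ↔ s ^ 2 ≤ 1 := by
          rw [Set.mem_Icc, ← abs_le, sq_le_one_iff_abs_le_one]
        rw [Set.indicator_apply]
        by_cases h : s ^ 2 ≤ 1
        · have hp : √(1 - s ^ 2) ^ m = (1 - s ^ 2) ^ ((m : ℝ) / 2) := by
            rw [Real.sqrt_eq_rpow, ← Real.rpow_natCast, ← Real.rpow_mul (by linarith)]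
            ring_nf
          rw [if_pos h, if_pos (hiff.2 h), hp, real_smul]
          push_cast
          ring
        · rw [if_neg h, if_neg (mt hiff.1 h), smul_zero]
    _ = _ := by
        rw [integral_indicator measurableSet_Icc, integral_Icc_eq_integral_Ioc,
          ← intervalIntegral.integral_of_le (by norm_num), intervalIntegral.integral_const_mul]

theorem ballTransform_linearIsometryEquiv {d : ℕ} (L : Euc d ≃ₗᵢ[ℝ] Euc d) (t : Euc d) :
    ballTransform (L t) = ballTransform t := by
  have h := L.measurePreserving.setIntegral_preimage_emb
    L.toHomeomorph.measurableEmbedding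
    (fun ω => cexp (I * ((⟪ω, L t⟫ : ℝ) : ℂ))) (Metric.closedBall (0 : Euc d) 1)
  rw [ballTransform, ← h, ballTransform]
  simp only [LinearIsometryEquiv.inner_map_map]
  congr 2
  ext ω
  simp

/-- The reflection exchanging two vectors of equal norm preserves the ball and its measure. -/
theorem ballTransform_eq_ballTransform_single {m : ℕ} (t : Euc (m + 1)) :
    ballTransform t = ballTransform (EuclideanSpace.single (0 : Fin (m + 1)) ‖t‖) := by
  rw [← Submodule.reflection_sub (v := t) (w := EuclideanSpace.single (0 : Fin (m + 1)) ‖t‖)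
    (by simp), ballTransform_linearIsometryEquiv]

theorem volume_real_closedBall_one (m : ℕ) :
    volume.real (Metric.closedBall (0 : Euc m) 1) =
      √Real.pi ^ m / Real.Gamma ((m : ℝ) / 2 + 1) := by
  rcases m with _ | m
  · simp [Measure.real, volume_euclideanSpace_eq_dirac]
  · rw [Measure.real, EuclideanSpace.volume_closedBall, ENNReal.ofReal_one, one_pow, one_mul,
      ENNReal.toReal_ofReal, Fintype.card_fin]
    have := Real.Gamma_pos_of_pos (s := ((m + 1 : ℕ) : ℝ) / 2 + 1) (by positivity)
    simp only [Fintype.card_fin]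
    positivity

theorem volume_real_closedBall_one_pos (m : ℕ) :
    0 < volume.real (Metric.closedBall (0 : Euc m) 1) := by
  rw [volume_real_closedBall_one]
  have := Real.Gamma_pos_of_pos (s := (m : ℝ) / 2 + 1) (by positivity)
  positivity

theorem norm_ballTransform_le {d : ℕ} (t : Euc d) :
    ‖ballTransform t‖ ≤ volume.real (Metric.closedBall (0 : Euc d) 1) := by
  refine (norm_setIntegral_le_of_norm_le_const (C := 1) measure_closedBall_lt_top
    fun ω _ => ?_).trans_eq (one_mul _)
  rw [mul_comm, norm_exp_ofReal_mul_I]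

/-- The decay of the Fourier integral of the indicator of the unit ball, relative to its value at
the origin. -/
theorem norm_ballTransform_sq_le {d : ℕ} (hd : 0 < d) {t : Euc d} (ht : t ≠ 0) :
    ‖ballTransform t‖ ^ 2 ≤ volume.real (Metric.closedBall (0 : Euc d) 1) ^ 2 *
      (Real.Gamma ((d : ℝ) / 2 + 1) ^ 2 / Real.pi * (4 / ‖t‖) ^ (d + 1)) := by
  have hz : 0 < ‖t‖ := norm_pos_iff.2 ht
  have hG := Real.Gamma_pos_of_pos (s := (d : ℝ) / 2 + 1) (by positivity)
  -- For `‖t‖ ≤ d/2` the factor on the right is at least 1. Otherwise the exponent `p = (d-1)/2`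
  -- lies below `‖t‖`, as the contour bound requires, and its `Γ(p+1)` cancels the one in the volume
  -- of the `(d-1)`-ball.
  rcases le_total ‖t‖ ((d : ℝ) / 2) with hle | hge
  · have h := Real.pi_mul_div_pow_le_Gamma_sq hd hz.le hle
    have h1 : (1 : ℝ) ≤ Real.Gamma ((d : ℝ) / 2 + 1) ^ 2 / Real.pi * (4 / ‖t‖) ^ (d + 1) := by
      rw [div_mul_eq_mul_div, le_div_iff₀ Real.pi_pos, one_mul, ← inv_div ‖t‖ 4, inv_pow,
        ← div_eq_mul_inv, le_div_iff₀ (by positivity)]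
      exact h
    calc ‖ballTransform t‖ ^ 2 ≤ volume.real (Metric.closedBall (0 : Euc d) 1) ^ 2 := by
          gcongr; exact norm_ballTransform_le t
      _ ≤ _ := le_mul_of_one_le_right (by positivity) h1
  · obtain ⟨m, rfl⟩ : ∃ m, d = m + 1 := ⟨d - 1, by omega⟩
    have hc := norm_integral_one_sub_sq_rpow_mul_cexp_le (p := (m : ℝ) / 2) (z := ‖t‖)
      (by positivity) hz (by push_cast at hge; linarith)
    have hGm := Real.Gamma_pos_of_pos (s := (m : ℝ) / 2 + 1) (by positivity)
    have hpow : ((4 / ‖t‖) ^ ((m : ℝ) / 2 + 1)) ^ 2 ≤ (4 / ‖t‖) ^ (m + 1 + 1) := by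
      rw [← Real.rpow_natCast, ← Real.rpow_mul (by positivity), ← Real.rpow_natCast]
      apply le_of_eq
      congr 1
      push_cast
      ring
    calc ‖ballTransform t‖ ^ 2 ≤ (√Real.pi ^ m / Real.Gamma ((m : ℝ) / 2 + 1) *
            ((4 / ‖t‖) ^ ((m : ℝ) / 2 + 1) * Real.Gamma ((m : ℝ) / 2 + 1))) ^ 2 := by
          rw [ballTransform_eq_ballTransform_single, ballTransform_single, norm_mul, norm_real,
            Real.norm_of_nonneg measureReal_nonneg, volume_real_closedBall_one]
          gcongr
      _ = (√Real.pi ^ m) ^ 2 * ((4 / ‖t‖) ^ ((m : ℝ) / 2 + 1)) ^ 2 := by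
          field_simp
      _ ≤ (√Real.pi ^ m) ^ 2 * (4 / ‖t‖) ^ (m + 1 + 1) := by gcongr
      _ = _ := by
          rw [volume_real_closedBall_one, pow_succ √Real.pi m,
            div_pow (_ * _), mul_pow (_ ^ m) √Real.pi, Real.sq_sqrt Real.pi_pos.le]
          field_simp

end Slicing

/-! ### Closed form of `Υ_M` and its value at the origin. -/

section Upsilon

open Complex

theorem ballIndicator_eq (d : ℕ) (M : ℝ) :
    ballIndicator d M = (Metric.closedBall (0 : Euc d) M).indicator 1 := by
  have : {ω : Euc d | ‖ω‖ ≤ M} = Metric.closedBall (0 : Euc d) M := by ext; simp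
  rw [ballIndicator, this]

theorem setIntegral_closedBall_cexp {d : ℕ} {M : ℝ} (hM : 0 < M) (t : Euc d) :
    ∫ ω in Metric.closedBall (0 : Euc d) M, cexp (I * ((⟪ω, t⟫ : ℝ) : ℂ)) =
      (M : ℂ) ^ d * ballTransform (M • t) := by
  have h := Measure.setIntegral_comp_smul_of_pos volume
    (fun ω : Euc d => cexp (I * ((⟪ω, t⟫ : ℝ) : ℂ))) (Metric.closedBall (0 : Euc d) 1) hM
  rw [smul_unitClosedBall, Real.norm_of_nonneg hM.le] at h
  rw [ballTransform]
  simp only [inner_smul_right, inner_smul_left, conj_trivial, finrank_euclideanSpace,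
    Fintype.card_fin] at h ⊢
  rw [h, real_smul]
  push_cast
  rw [mul_inv_cancel_left₀]
  exact pow_ne_zero _ (by exact_mod_cast hM.ne')

theorem ballTransform_zero (d : ℕ) :
    ballTransform (0 : Euc d) = volume.real (Metric.closedBall (0 : Euc d) 1) := by
  simp [ballTransform]

theorem continuous_ballTransform (d : ℕ) : Continuous (ballTransform (d := d)) := by
  unfold ballTransform
  exact continuous_parametric_integral_of_continuous (by fun_prop) (isCompact_closedBall _ _)

/-- The character is multiplicative, so it distributes over the two convolution factors, and the
integral of a convolution is the product of the integrals. -/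
theorem integral_convolution_ballIndicator_mul_cexp {d : ℕ} (M : ℝ) (t : Euc d) :
    ∫ ω, (((ballIndicator d M ⋆[ContinuousLinearMap.mul ℝ ℝ, volume] ballIndicator d M) ω : ℝ) : ℂ)
        * cexp (I * ((⟪ω, t⟫ : ℝ) : ℂ)) =
      (∫ ω in Metric.closedBall (0 : Euc d) M, cexp (I * ((⟪ω, t⟫ : ℝ) : ℂ))) ^ 2 := by
  set F : Euc d → ℂ := (Metric.closedBall (0 : Euc d) M).indicator
    fun ω => cexp (I * ((⟪ω, t⟫ : ℝ) : ℂ)) with hF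
  have hFint : Integrable F := by
    rw [hF, integrable_indicator_iff measurableSet_closedBall]
    exact ContinuousOn.integrableOn_compact (isCompact_closedBall _ _)
      (Continuous.continuousOn (by fun_prop))
  have hFeq : ∀ ω, F ω = (ballIndicator d M ω : ℂ) * cexp (I * ((⟪ω, t⟫ : ℝ) : ℂ)) := by
    intro ω
    rw [ballIndicator_eq, hF]
    by_cases h : ω ∈ Metric.closedBall (0 : Euc d) M
    · simp only [Set.indicator_of_mem h, Pi.one_apply, ofReal_one, one_mul]
    · simp only [Set.indicator_of_notMem h, ofReal_zero, zero_mul]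
  have h := integral_convolution (ContinuousLinearMap.mul ℝ ℂ) hFint hFint
  rw [ContinuousLinearMap.mul_apply', ← sq, hF, integral_indicator measurableSet_closedBall,
    ← hF] at h
  rw [← h]
  refine integral_congr_ae (Eventually.of_forall fun ω => ?_)
  simp only [convolution, ContinuousLinearMap.mul_apply', hFeq]
  rw [← integral_complex_ofReal, ← integral_mul_const]
  refine integral_congr_ae (Eventually.of_forall fun y => ?_)
  have : cexp (I * ((⟪ω, t⟫ : ℝ) : ℂ)) =
      cexp (I * ((⟪y, t⟫ : ℝ) : ℂ)) * cexp (I * ((⟪ω - y, t⟫ : ℝ) : ℂ)) := by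
    rw [← Complex.exp_add, inner_sub_left]
    push_cast
    ring_nf
  simp only [this]
  push_cast
  ring

theorem sqrt_pi_pow (d : ℕ) : √Real.pi ^ d = Real.pi ^ ((d : ℝ) / 2) := by
  rw [Real.sqrt_eq_rpow, ← Real.rpow_natCast, ← Real.rpow_mul Real.pi_pos.le]
  ring_nf

theorem two_pi_rpow_neg_div_two (d : ℕ) :
    (2 * Real.pi) ^ (-(d : ℝ) / 2) = (√2 ^ d * √Real.pi ^ d)⁻¹ := by
  rw [← mul_pow, ← Real.sqrt_mul (by norm_num), neg_div, Real.rpow_neg (by positivity),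
    Real.sqrt_eq_rpow, ← Real.rpow_natCast, ← Real.rpow_mul (by positivity)]
  ring_nf

/-- `Υ_M(t)` is `Υ_M(0)` times the square of the normalized Fourier integral of the ball. -/
theorem upsilon_eq {d : ℕ} (Φ : Euc d → ℝ) {M : ℝ} (hM : 0 < M) (t : Euc d) :
    upsilon Φ M t = upsilonZero Φ M *
      (ballTransform (M • t) / volume.real (Metric.closedBall (0 : Euc d) 1)) ^ 2 := by
  have hG := Real.Gamma_pos_of_pos (s := (d : ℝ) / 2 + 1) (by positivity)
  have hv := volume_real_closedBall_one_pos d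
  set V := volume.real (Metric.closedBall (0 : Euc d) 1) with hV
  have hc : (2 * Real.pi) ^ (-(d : ℝ) / 2) * (fourierHatInf Φ M * Real.Gamma ((d : ℝ) / 2 + 1) /
      ((2 : ℝ) ^ d * M ^ d * Real.pi ^ ((d : ℝ) / 2))) * (M ^ d) ^ 2 =
      upsilonZero Φ M / V ^ 2 := by
    -- In `2^(3/2)` the factor 2 comes from the `2^d` in `upsilonHat`, and `√2` from `(2π)^(-d/2)`.
    have h2 : (2 : ℝ) ^ (3 / 2 : ℝ) = 2 * √2 := by
      rw [show (3 / 2 : ℝ) = 1 + 1 / 2 by norm_num, Real.rpow_add (by norm_num), Real.rpow_one,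
        Real.sqrt_eq_rpow]
    rw [two_pi_rpow_neg_div_two, hV, volume_real_closedBall_one, ← sqrt_pi_pow, upsilonZero, h2,
      div_pow M, mul_pow 2 √2]
    have : 0 < √2 := by positivity
    have : 0 < √Real.pi := by positivity
    field_simp
  have hc' := congrArg (fun r : ℝ => (r : ℂ)) hc
  push_cast at hc'
  unfold upsilon fourierCheck upsilonHat
  simp only [ofReal_mul, mul_assoc]
  rw [integral_const_mul, integral_convolution_ballIndicator_mul_cexp,
    setIntegral_closedBall_cexp hM]
  push_cast
  rw [div_pow, mul_pow]
  linear_combination (ballTransform (M • t)) ^ 2 * hc'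

theorem tendsto_upsilon {d : ℕ} (Φ : Euc d → ℝ) {M : ℝ} (hM : 0 < M) :
    Tendsto (upsilon Φ M) (𝓝[≠] 0) (𝓝 (upsilonZero Φ M : ℂ)) := by
  have hv := volume_real_closedBall_one_pos d
  have hcont : Continuous (upsilon Φ M) := by
    rw [funext (upsilon_eq Φ hM)]
    have := (continuous_ballTransform d).comp (continuous_const_smul M)
    fun_prop
  have h0 : upsilon Φ M 0 = upsilonZero Φ M := by
    rw [upsilon_eq Φ hM, smul_zero, ballTransform_zero, div_self, one_pow, mul_one]
    exact_mod_cast hv.ne'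
  rw [← h0]
  exact hcont.continuousAt.tendsto.mono_left nhdsWithin_le_nhds

end Upsilon

/-! ### Nonnegativity of the Fourier transform of a positive definite function. -/

section PosDef

variable {d : ℕ} {Φ : Euc d → ℝ}

theorem IsPosDefKernel.sum_finset_nonneg (hΦ : IsPosDefKernel Φ) (F : Finset (Euc d))
    (w : Euc d → ℝ) : 0 ≤ ∑ a ∈ F, ∑ b ∈ F, w a * w b * Φ (a - b) := by
  have hsum : ∑ a ∈ F, ∑ b ∈ F, w a * w b * Φ (a - b) =
      ∑ j : Fin F.card, ∑ k : Fin F.card, w (F.equivFin.symm j) * w (F.equivFin.symm k) *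
        Φ ((F.equivFin.symm j : Euc d) - F.equivFin.symm k) := by
    rw [← Finset.sum_coe_sort, ← F.equivFin.symm.sum_comp]
    refine Finset.sum_congr rfl fun j _ => ?_
    rw [← Finset.sum_coe_sort, ← F.equivFin.symm.sum_comp]
  rw [hsum]
  by_cases h : (fun j : Fin F.card => w (F.equivFin.symm j)) = 0
  · have h' : ∀ j, w (F.equivFin.symm j) = 0 := fun j => congrFun h j
    simp [h']
  · exact (hΦ.pos _ (fun j => (F.equivFin.symm j : Euc d))
      (Subtype.val_injective.comp F.equivFin.symm.injective) _ h).le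

/-- Two-point forms at `0, z` with weights `(1, 1)` and `(1, -1)`; boundedness is what dominated
convergence needs below. -/
theorem IsPosDefKernel.abs_apply_le (hΦ : IsPosDefKernel Φ) (z : Euc d) : |Φ z| ≤ Φ 0 := by
  by_cases hz : z = 0
  · subst hz
    have h := hΦ.sum_finset_nonneg {0} 1
    simp only [Finset.sum_singleton, Pi.one_apply, sub_self, mul_one, one_mul] at h
    rw [abs_of_nonneg h]
  · have h1 := hΦ.sum_finset_nonneg {0, z} 1
    have h2 := hΦ.sum_finset_nonneg {0, z} (fun a => if a = 0 then 1 else -1)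
    rw [abs_le]
    simp [Finset.sum_pair (Ne.symm hz), hΦ.even, hz] at h1 h2
    constructor <;> linarith

/-- Rounding both points by simple functions `s n → id` turns the integral into a finite quadratic
form, whose weights are the integrals of `w` over the fibres of `s n`. Continuity of `Φ` and the
bound `Φ 0` allow passage to the limit. -/
theorem IsPosDefKernel.integral_prod_nonneg (hΦ : IsPosDefKernel Φ) {w : Euc d → ℝ}
    (hw : Integrable w) :
    0 ≤ ∫ p : Euc d × Euc d, Φ (p.1 - p.2) * (w p.1 * w p.2) := by
  set s := SimpleFunc.approxOn (id : Euc d → Euc d) measurable_id Set.univ 0 (Set.mem_univ _)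
  have hs : ∀ x, Tendsto (fun n => s n x) atTop (𝓝 x) := fun x =>
    SimpleFunc.tendsto_approxOn measurable_id (Set.mem_univ _) (by simp)
  have hww : Integrable (fun p : Euc d × Euc d => w p.1 * w p.2) := hw.mul_prod hw
  have hmeas : ∀ n, AEStronglyMeasurable
      (fun p : Euc d × Euc d => Φ (s n p.1 - s n p.2) * (w p.1 * w p.2)) := by
    intro n
    refine AEStronglyMeasurable.mul ?_ hww.1
    have h : Measurable fun p : Euc d × Euc d => s n p.1 - s n p.2 :=
      ((s n).measurable.comp measurable_fst).sub ((s n).measurable.comp measurable_snd)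
    exact (hΦ.continuous.measurable.comp h).aestronglyMeasurable
  have hlim := tendsto_integral_of_dominated_convergence
    (F := fun n (p : Euc d × Euc d) => Φ (s n p.1 - s n p.2) * (w p.1 * w p.2))
    (f := fun p => Φ (p.1 - p.2) * (w p.1 * w p.2))
    (bound := fun p => Φ 0 * ‖w p.1 * w p.2‖) hmeas (hww.norm.const_mul _)
    (fun n => Eventually.of_forall fun p => by
      rw [norm_mul]
      gcongr
      exact hΦ.abs_apply_le _)
    (Eventually.of_forall fun p => Tendsto.mul_const _
      ((hΦ.continuous.tendsto _).comp ((hs p.1).sub (hs p.2))))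
  refine ge_of_tendsto hlim (Eventually.of_forall fun n => ?_)
  set W : Euc d → ℝ := fun a => ∫ x, (s n ⁻¹' {a}).indicator w x with hW
  have hind : ∀ a, Integrable ((s n ⁻¹' {a}).indicator w) := fun a =>
    hw.indicator ((s n).measurableSet_fiber a)
  have hdec : ∀ p : Euc d × Euc d, Φ (s n p.1 - s n p.2) * (w p.1 * w p.2) =
      ∑ a ∈ (s n).range, ∑ b ∈ (s n).range, Φ (a - b) *
        ((s n ⁻¹' {a}).indicator w p.1 * (s n ⁻¹' {b}).indicator w p.2) := by
    intro p
    rw [Finset.sum_eq_single_of_mem (s n p.1) (SimpleFunc.mem_range_self _ _),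
      Finset.sum_eq_single_of_mem (s n p.2) (SimpleFunc.mem_range_self _ _)]
    · simp
    · intro b _ hb
      rw [Set.indicator_of_notMem (s := s n ⁻¹' {b}) (by simpa using hb.symm), mul_zero, mul_zero]
    · intro a _ ha
      refine Finset.sum_eq_zero fun b _ => ?_
      rw [Set.indicator_of_notMem (s := s n ⁻¹' {a}) (by simpa using ha.symm), zero_mul, mul_zero]
  have hint : ∀ a b, Integrable fun p : Euc d × Euc d => Φ (a - b) *
        ((s n ⁻¹' {a}).indicator w p.1 * (s n ⁻¹' {b}).indicator w p.2) := fun a b =>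
    ((hind a).mul_prod (hind b)).const_mul _
  simp only [hdec]
  rw [integral_finsetSum _ fun a _ => integrable_finsetSum _ fun b _ => hint a b]
  refine (hΦ.sum_finset_nonneg (s n).range W).trans_eq (Finset.sum_congr rfl fun a _ => ?_)
  rw [integral_finsetSum _ fun b _ => hint a b]
  refine Finset.sum_congr rfl fun b _ => ?_
  have := integral_prod_mul (μ := (volume : Measure (Euc d))) (ν := (volume : Measure (Euc d)))
    ((s n ⁻¹' {a}).indicator w) ((s n ⁻¹' {b}).indicator w)
  rw [integral_const_mul, Measure.volume_eq_prod, this, mul_comm]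

theorem integrable_exp_neg_mul_norm_sq {ε : ℝ} (hε : 0 < ε) :
    Integrable fun x : Euc d => Real.exp (-ε * ‖x‖ ^ 2) := by
  have h := (GaussianFourier.integrable_cexp_neg_mul_sq_norm_add (V := Euc d) (b := ε)
    (by simpa using hε) 0 0).re
  refine h.congr (Eventually.of_forall fun x => ?_)
  simp only [zero_mul, add_zero]
  rw [← Complex.exp_ofReal_re]
  push_cast
  rfl

/-- The weights `cos ⟪ω, x⟫ γ(x)` and `sin ⟪ω, x⟫ γ(x)` add up to `Φ(x-y) cos ⟪ω, x-y⟫ γ(x) γ(y)`.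
The Gaussian `γ` makes the weights integrable. After `x = y + z`, completing the square separates
the variables, and the `y`-integral is a positive constant. -/
theorem IsPosDefKernel.integral_mul_gaussian_nonneg (hΦ : IsPosDefKernel Φ)
    (hint : Integrable Φ) (ω : Euc d) {ε : ℝ} (hε : 0 < ε) :
    0 ≤ ∫ z, Φ z * Real.cos ⟪ω, z⟫ * Real.exp (-(ε / 2) * ‖z‖ ^ 2) := by
  set γ : Euc d → ℝ := fun x => Real.exp (-ε * ‖x‖ ^ 2) with hγ
  have hγi : Integrable γ := integrable_exp_neg_mul_norm_sq hε
  have hγ1 : ∀ x, γ x ≤ 1 := fun x => Real.exp_le_one_iff.2 (by nlinarith [sq_nonneg ‖x‖])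
  have hγc : Continuous γ := by fun_prop
  have hc : Integrable fun x => Real.cos ⟪ω, x⟫ * γ x :=
    hγi.bdd_mul (c := 1) (by fun_prop) (Eventually.of_forall fun x => Real.abs_cos_le_one _)
  have hs : Integrable fun x => Real.sin ⟪ω, x⟫ * γ x :=
    hγi.bdd_mul (c := 1) (by fun_prop) (Eventually.of_forall fun x => Real.abs_sin_le_one _)
  have hb : ∀ {w : Euc d → ℝ}, Integrable w →
      Integrable fun p : Euc d × Euc d => Φ (p.1 - p.2) * (w p.1 * w p.2) := fun hw =>
    (hw.mul_prod hw).bdd_mul (c := Φ 0)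
      (hΦ.continuous.comp (continuous_fst.sub continuous_snd)).aestronglyMeasurable
      (Eventually.of_forall fun p => hΦ.abs_apply_le _)
  set H : Euc d → ℝ := fun z => Φ z * Real.cos ⟪ω, z⟫ with hH
  have hHi : Integrable H :=
    (hint.bdd_mul (c := 1) (f := fun x => Real.cos ⟪ω, x⟫) (by fun_prop)
      (Eventually.of_forall fun x => Real.abs_cos_le_one _)).congr
      (Eventually.of_forall fun x => mul_comm _ _)
  have hadd := add_nonneg (hΦ.integral_prod_nonneg hc) (hΦ.integral_prod_nonneg hs)
  rw [← integral_add (hb hc) (hb hs)] at hadd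
  have e1 : ∀ p : Euc d × Euc d,
      Φ (p.1 - p.2) * ((Real.cos ⟪ω, p.1⟫ * γ p.1) * (Real.cos ⟪ω, p.2⟫ * γ p.2)) +
      Φ (p.1 - p.2) * ((Real.sin ⟪ω, p.1⟫ * γ p.1) * (Real.sin ⟪ω, p.2⟫ * γ p.2)) =
      H (p.1 - p.2) * (γ p.1 * γ p.2) := by
    intro p
    simp only [hH, inner_sub_right, Real.cos_sub]
    ring
  have hpi : Integrable fun p : Euc d × Euc d => H (p.1 - p.2) * (γ p.1 * γ p.2) :=
    ((hb hc).add (hb hs)).congr (Eventually.of_forall e1)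
  have hqi : Integrable fun p : Euc d × Euc d => γ (p.1 + p.2) * (γ p.1 * H p.2) :=
    (hγi.mul_prod hHi).bdd_mul (c := 1) (by fun_prop) (Eventually.of_forall fun p => by
      rw [Real.norm_of_nonneg (Real.exp_nonneg _)]; exact hγ1 _)
  simp only [e1] at hadd
  have hid : ∀ y z : Euc d, γ (y + z) * (γ y * H z) =
      (H z * Real.exp (-(ε / 2) * ‖z‖ ^ 2)) *
        Real.exp (-(2 * ε) * ‖y + (2 : ℝ)⁻¹ • z‖ ^ 2) := by
    intro y z
    simp only [hγ]
    have : Real.exp (-ε * ‖y + z‖ ^ 2) * Real.exp (-ε * ‖y‖ ^ 2) =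
        Real.exp (-(ε / 2) * ‖z‖ ^ 2) * Real.exp (-(2 * ε) * ‖y + (2 : ℝ)⁻¹ • z‖ ^ 2) := by
      rw [← Real.exp_add, ← Real.exp_add, norm_add_sq_real, norm_add_sq_real, inner_smul_right,
        norm_smul]
      norm_num
      ring
    rw [← mul_assoc, this]
    ring
  have hval : ∫ p : Euc d × Euc d, H (p.1 - p.2) * (γ p.1 * γ p.2) =
      (∫ z, H z * Real.exp (-(ε / 2) * ‖z‖ ^ 2)) *
        ∫ y : Euc d, Real.exp (-(2 * ε) * ‖y‖ ^ 2) := by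
    calc ∫ p : Euc d × Euc d, H (p.1 - p.2) * (γ p.1 * γ p.2)
        = ∫ y, ∫ x, H (x - y) * (γ x * γ y) := integral_prod_symm _ hpi
      _ = ∫ y, ∫ z, γ (y + z) * (γ y * H z) := by
          refine integral_congr_ae (Eventually.of_forall fun y => ?_)
          simp only
          rw [← integral_add_left_eq_self _ y]
          refine integral_congr_ae (Eventually.of_forall fun z => ?_)
          simp only [add_sub_cancel_left]
          ring
      _ = ∫ z, ∫ y, γ (y + z) * (γ y * H z) := integral_integral_swap hqi
      _ = _ := by
          rw [← integral_mul_const]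
          refine integral_congr_ae (Eventually.of_forall fun z => ?_)
          simp only [hid]
          rw [integral_const_mul,
            integral_add_right_eq_self (fun y : Euc d => Real.exp (-(2 * ε) * ‖y‖ ^ 2))]
  rw [hval] at hadd
  have hpos : 0 < ∫ y : Euc d, Real.exp (-(2 * ε) * ‖y‖ ^ 2) :=
    integral_exp_pos (integrable_exp_neg_mul_norm_sq (by positivity))
  exact nonneg_of_mul_nonneg_left hadd hpos

/-- The Gaussian is removed by letting its parameter tend to 0, with `|Φ|` as majorant. -/
theorem IsPosDefKernel.integral_mul_cos_nonneg (hΦ : IsPosDefKernel Φ)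
    (hint : Integrable Φ) (ω : Euc d) : 0 ≤ ∫ z, Φ z * Real.cos ⟪ω, z⟫ := by
  have hcont := hΦ.continuous
  have hlim := tendsto_integral_of_dominated_convergence (μ := (volume : Measure (Euc d)))
    (F := fun (n : ℕ) z =>
      Φ z * Real.cos ⟪ω, z⟫ * Real.exp (-((1 / ((n : ℝ) + 1)) / 2) * ‖z‖ ^ 2))
    (f := fun z => Φ z * Real.cos ⟪ω, z⟫)
    (bound := fun z => ‖Φ z‖)
    (fun n => Continuous.aestronglyMeasurable (by fun_prop)) hint.norm
    (fun n => Eventually.of_forall fun z => by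
      have h1 : Real.exp (-((1 / ((n : ℝ) + 1)) / 2) * ‖z‖ ^ 2) ≤ 1 := by
        rw [Real.exp_le_one_iff, neg_mul, neg_nonpos]
        positivity
      rw [norm_mul, norm_mul, Real.norm_of_nonneg (Real.exp_nonneg _), mul_assoc]
      refine mul_le_of_le_one_right (norm_nonneg _) ?_
      exact mul_le_one₀ (Real.abs_cos_le_one _) (Real.exp_nonneg _) h1)
    (Eventually.of_forall fun z => by
      have h0 := (tendsto_one_div_add_atTop_nhds_zero_nat (𝕜 := ℝ))
      have h1 : Tendsto (fun n : ℕ => Real.exp (-((1 / ((n : ℝ) + 1)) / 2) * ‖z‖ ^ 2)) atTop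
          (𝓝 (Real.exp (-(0 / 2) * ‖z‖ ^ 2))) :=
        (Real.continuous_exp.tendsto _).comp (((h0.div_const 2).neg).mul_const _)
      simpa using h1.const_mul (Φ z * Real.cos ⟪ω, z⟫))
  exact ge_of_tendsto hlim (Eventually.of_forall fun n =>
    hΦ.integral_mul_gaussian_nonneg hint ω (by positivity))

end PosDef

/-! ### Fourier inversion and comparison of quadratic forms. -/

section Inversion

open Complex

variable {d : ℕ}

theorem re_ofReal_mul_cexp_I_mul (a b : ℝ) : ((a : ℂ) * cexp (I * b)).re = a * Real.cos b := by
  rw [re_ofReal_mul, mul_comm I, exp_ofReal_mul_I_re]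

theorem Integrable.mul_cexp_I_inner {g : Euc d → ℂ} (hg : Integrable g) (t : Euc d) :
    Integrable fun ω => g ω * cexp (I * ((⟪ω, t⟫ : ℝ) : ℂ)) :=
  (hg.bdd_mul (c := 1) (f := fun ω : Euc d => cexp (I * ((⟪ω, t⟫ : ℝ) : ℂ)))
    (Continuous.aestronglyMeasurable (by fun_prop)) (Eventually.of_forall fun ω => by
      rw [mul_comm, norm_exp_ofReal_mul_I])).congr (Eventually.of_forall fun ω => mul_comm _ _)

theorem Integrable.mul_cos_inner {g : Euc d → ℝ} (hg : Integrable g) (t : Euc d) :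
    Integrable fun ω => g ω * Real.cos ⟪ω, t⟫ := by
  refine (Integrable.mul_cexp_I_inner hg.ofReal t).re.congr (Eventually.of_forall fun ω => ?_)
  exact re_ofReal_mul_cexp_I_mul _ _

theorem fourierCheck_re {g : Euc d → ℝ} (hg : Integrable g) (t : Euc d) :
    (fourierCheck g t).re =
      (2 * Real.pi) ^ (-(d : ℝ) / 2) * ∫ ω, g ω * Real.cos ⟪ω, t⟫ := by
  rw [fourierCheck, re_ofReal_mul]
  congr 1
  refine (integral_re (Integrable.mul_cexp_I_inner hg.ofReal t)).symm.trans ?_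
  exact integral_congr_ae (Eventually.of_forall fun ω => re_ofReal_mul_cexp_I_mul _ _)

theorem fourierHat_eq_fourierCheck_neg (f : Euc d → ℝ) (ω : Euc d) :
    fourierHat f ω = fourierCheck f (-ω) := by
  simp [fourierHat, fourierCheck, inner_neg_right, real_inner_comm]

theorem fourierHat_re {f : Euc d → ℝ} (hf : Integrable f) (ω : Euc d) :
    (fourierHat f ω).re =
      (2 * Real.pi) ^ (-(d : ℝ) / 2) * ∫ x, f x * Real.cos ⟪ω, x⟫ := by
  rw [fourierHat_eq_fourierCheck_neg, fourierCheck_re hf]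
  simp [inner_neg_right, real_inner_comm]

theorem IsPosDefKernel.fourierHat_re_nonneg {Φ : Euc d → ℝ} (hΦ : IsPosDefKernel Φ)
    (hint : Integrable Φ) (ω : Euc d) : 0 ≤ (fourierHat Φ ω).re := by
  rw [fourierHat_re hint]
  have := hΦ.integral_mul_cos_nonneg hint ω
  positivity

open FourierTransform in
theorem fourierHat_two_pi_smul (f : Euc d → ℝ) (ξ : Euc d) :
    fourierHat f ((2 * Real.pi) • ξ) =
      (((2 * Real.pi) ^ (-(d : ℝ) / 2) : ℝ) : ℂ) * 𝓕 (fun x => (f x : ℂ)) ξ := by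
  rw [fourierHat, Real.fourier_eq']
  congr 1
  refine integral_congr_ae (Eventually.of_forall fun x => ?_)
  simp only [smul_eq_mul, inner_smul_left, conj_trivial, real_inner_comm x ξ]
  rw [mul_comm]
  congr 2
  push_cast
  ring

open FourierTransform in
/-- Fourier inversion in the unitary normalization with angular frequency. -/
theorem eq_integral_fourierHat_mul_cexp {f : Euc d → ℝ} (hc : Continuous f) (hf : Integrable f)
    (hhat : Integrable (fourierHat f)) (t : Euc d) :
    (f t : ℂ) = (((2 * Real.pi) ^ (-(d : ℝ) / 2) : ℝ) : ℂ) *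
      ∫ ω, fourierHat f ω * cexp (I * ((⟪ω, t⟫ : ℝ) : ℂ)) := by
  set κ : ℝ := (2 * Real.pi) ^ (-(d : ℝ) / 2) with hκ
  have hκpos : 0 < κ := by positivity
  have hκ0 : (κ : ℂ) ≠ 0 := by exact_mod_cast hκpos.ne'
  have h2π : 2 * Real.pi ≠ 0 := by positivity
  have hF : ∀ ξ, 𝓕 (fun x => (f x : ℂ)) ξ = (κ : ℂ)⁻¹ * fourierHat f ((2 * Real.pi) • ξ) := by
    intro ξ
    rw [fourierHat_two_pi_smul, inv_mul_cancel_left₀ hκ0]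
  have hFint : Integrable (𝓕 (fun x => (f x : ℂ))) :=
    ((hhat.comp_smul h2π).const_mul (κ : ℂ)⁻¹).congr
      (Eventually.of_forall fun ξ => (hF ξ).symm)
  have hinv := congrFun (Continuous.fourierInv_fourier_eq
    (continuous_ofReal.comp hc) hf.ofReal hFint) t
  have hsc := Measure.integral_comp_smul volume
    (fun ω : Euc d => fourierHat f ω * cexp (I * ((⟪ω, t⟫ : ℝ) : ℂ))) (2 * Real.pi)
  -- The Jacobian of `ω = 2πξ` supplies two factors `κ`: one cancels `κ⁻¹`, the other is the
  -- constant of the inverse transform.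
  have hκκ : |((2 * Real.pi) ^ d)⁻¹| = κ * κ := by
    rw [abs_of_pos (by positivity), hκ, ← Real.rpow_add (by positivity), ← Real.rpow_natCast,
      ← Real.rpow_neg (by positivity)]
    ring_nf
  rw [finrank_euclideanSpace, Fintype.card_fin, hκκ, real_smul] at hsc
  calc (f t : ℂ) = 𝓕⁻ (𝓕 (fun x => (f x : ℂ))) t := hinv.symm
    _ = (κ : ℂ)⁻¹ * ∫ ξ : Euc d, fourierHat f ((2 * Real.pi) • ξ) *
          cexp (I * ((⟪(2 * Real.pi) • ξ, t⟫ : ℝ) : ℂ)) := by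
        rw [Real.fourierInv_eq', ← integral_const_mul]
        refine integral_congr_ae (Eventually.of_forall fun ξ => ?_)
        simp only [smul_eq_mul, hF, inner_smul_left, conj_trivial]
        rw [mul_comm (cexp _), mul_assoc, mul_comm I]
    _ = _ := by
        rw [hsc]
        push_cast
        field_simp

theorem eq_integral_fourierHat_re_mul_cos {f : Euc d → ℝ} (he : ∀ x, f (-x) = f x)
    (hc : Continuous f) (hf : Integrable f) (hhat : Integrable (fourierHat f)) (t : Euc d) :
    f t = (2 * Real.pi) ^ (-(d : ℝ) / 2) * ∫ ω, (fourierHat f ω).re * Real.cos ⟪ω, t⟫ := by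
  have hre : ∀ ω, fourierHat f ω = ((fourierHat f ω).re : ℂ) := fun ω =>
    Complex.ext rfl (by rw [fourierHat_im_eq_zero he, ofReal_im])
  have hint : Integrable fun ω => (fourierHat f ω).re := hhat.re
  rw [← fourierCheck_re hint, fourierCheck]
  refine (ofReal_re (f t)).symm.trans ?_
  rw [eq_integral_fourierHat_mul_cexp hc hf hhat t]
  simp only [← hre]

/-- The two squares are `|∑ α_j exp(iω'y_j)|²` in real form. Its nonnegativity makes the quadratic
form monotone in `g`. -/
theorem sum_sum_integral_mul_cos {n : ℕ} {g : Euc d → ℝ} (hg : Integrable g)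
    (y : Fin n → Euc d) (α : Fin n → ℝ) :
    Integrable (fun ω => g ω * ((∑ j, α j * Real.cos ⟪ω, y j⟫) ^ 2 +
      (∑ j, α j * Real.sin ⟪ω, y j⟫) ^ 2)) ∧
    ∑ j, ∑ k, α j * α k * ∫ ω, g ω * Real.cos ⟪ω, y j - y k⟫ =
      ∫ ω, g ω * ((∑ j, α j * Real.cos ⟪ω, y j⟫) ^ 2 +
        (∑ j, α j * Real.sin ⟪ω, y j⟫) ^ 2) := by
  have hid : ∀ ω, ∑ j, ∑ k, α j * α k * (g ω * Real.cos ⟪ω, y j - y k⟫) =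
      g ω * ((∑ j, α j * Real.cos ⟪ω, y j⟫) ^ 2 + (∑ j, α j * Real.sin ⟪ω, y j⟫) ^ 2) := by
    intro ω
    rw [sq, sq, Finset.sum_mul_sum, Finset.sum_mul_sum, ← Finset.sum_add_distrib,
      Finset.mul_sum]
    refine Finset.sum_congr rfl fun j _ => ?_
    rw [← Finset.sum_add_distrib, Finset.mul_sum]
    refine Finset.sum_congr rfl fun k _ => ?_
    rw [inner_sub_right, Real.cos_sub]
    ring
  have hi : ∀ j k, Integrable fun ω => α j * α k * (g ω * Real.cos ⟪ω, y j - y k⟫) :=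
    fun j k => (Integrable.mul_cos_inner hg _).const_mul _
  simp only [← hid]
  refine ⟨integrable_finsetSum _ fun j _ => integrable_finsetSum _ fun k _ => hi j k, ?_⟩
  rw [integral_finsetSum _ fun j _ => integrable_finsetSum _ fun k _ => hi j k]
  refine Finset.sum_congr rfl fun j _ => ?_
  rw [integral_finsetSum _ fun k _ => hi j k]
  refine Finset.sum_congr rfl fun k _ => ?_
  rw [integral_const_mul]

theorem sum_sum_integral_mul_cos_mono {n : ℕ} {g h : Euc d → ℝ} (hg : Integrable g)
    (hh : Integrable h) (hgh : ∀ ω, g ω ≤ h ω) (y : Fin n → Euc d) (α : Fin n → ℝ) :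
    ∑ j, ∑ k, α j * α k * ∫ ω, g ω * Real.cos ⟪ω, y j - y k⟫ ≤
      ∑ j, ∑ k, α j * α k * ∫ ω, h ω * Real.cos ⟪ω, y j - y k⟫ := by
  rw [(sum_sum_integral_mul_cos hg y α).2, (sum_sum_integral_mul_cos hh y α).2]
  refine integral_mono (sum_sum_integral_mul_cos hg y α).1 (sum_sum_integral_mul_cos hh y α).1
    fun ω => ?_
  exact mul_le_mul_of_nonneg_right (hgh ω) (by positivity)

theorem integrable_ballIndicator (d : ℕ) (M : ℝ) : Integrable (ballIndicator d M) := by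
  rw [ballIndicator_eq, integrable_indicator_iff measurableSet_closedBall]
  exact integrableOn_const measure_closedBall_lt_top.ne

theorem integrable_upsilonHat (Φ : Euc d → ℝ) (M : ℝ) : Integrable (upsilonHat Φ M) :=
  ((integrable_ballIndicator d M).integrable_convolution (ContinuousLinearMap.mul ℝ ℝ)
    (integrable_ballIndicator d M)).const_mul _

theorem ballIndicator_nonneg (M : ℝ) (ω : Euc d) : 0 ≤ ballIndicator d M ω :=
  Set.indicator_nonneg (fun _ _ => zero_le_one) ω

theorem ballIndicator_le_one (M : ℝ) (ω : Euc d) : ballIndicator d M ω ≤ 1 :=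
  Set.indicator_le_self' (fun _ _ => zero_le_one) ω

theorem convolution_ballIndicator_le {M : ℝ} (hM : 0 < M) (ω : Euc d) :
    (ballIndicator d M ⋆[ContinuousLinearMap.mul ℝ ℝ, volume] ballIndicator d M) ω ≤
      M ^ d * volume.real (Metric.closedBall (0 : Euc d) 1) := by
  rw [← volume_real_closedBall_euc hM.le]
  have hval : ∫ y, ballIndicator d M y = volume.real (Metric.closedBall (0 : Euc d) M) := by
    rw [ballIndicator_eq, integral_indicator measurableSet_closedBall]
    simp
  rw [← hval, convolution]
  refine integral_mono_of_nonneg (Eventually.of_forall fun y => ?_) (integrable_ballIndicator d M)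
    (Eventually.of_forall fun y => ?_)
  · exact mul_nonneg (ballIndicator_nonneg _ _) (ballIndicator_nonneg _ _)
  · exact mul_le_of_le_one_right (ballIndicator_nonneg _ _) (ballIndicator_le_one _ _)

theorem convolution_ballIndicator_eq_zero {M : ℝ} {ω : Euc d} (hω : 2 * M < ‖ω‖) :
    (ballIndicator d M ⋆[ContinuousLinearMap.mul ℝ ℝ, volume] ballIndicator d M) ω = 0 := by
  rw [convolution]
  refine integral_eq_zero_of_ae (Eventually.of_forall fun y => ?_)
  simp only [ContinuousLinearMap.mul_apply', Pi.zero_apply, ballIndicator_eq]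
  by_cases h1 : y ∈ Metric.closedBall (0 : Euc d) M
  · rw [Set.indicator_of_notMem (a := ω - y), mul_zero]
    intro h2
    rw [mem_closedBall_zero_iff] at h1 h2
    have := norm_add_le y (ω - y)
    rw [add_sub_cancel] at this
    linarith
  · rw [Set.indicator_of_notMem h1, zero_mul]

variable {Φ : Euc d → ℝ}

theorem IsPosDefKernel.fourierHatInf_nonneg (hΦ : IsPosDefKernel Φ) (hint : Integrable Φ)
    (M : ℝ) : 0 ≤ fourierHatInf Φ M :=
  Real.sInf_nonneg (by rintro _ ⟨ω, _, rfl⟩; exact hΦ.fourierHat_re_nonneg hint ω)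

theorem IsPosDefKernel.fourierHatInf_le (hΦ : IsPosDefKernel Φ) (hint : Integrable Φ)
    {M : ℝ} {ω : Euc d} (hω : ‖ω‖ ≤ 2 * M) : fourierHatInf Φ M ≤ (fourierHat Φ ω).re :=
  csInf_le ⟨0, by rintro _ ⟨ω, _, rfl⟩; exact hΦ.fourierHat_re_nonneg hint ω⟩ ⟨ω, hω, rfl⟩

/-- Up to the slack `2^d`, the normalizing constant is the infimum divided by the volume of the
`M`-ball, which bounds the convolution. Beyond radius `2M` the convolution vanishes and
nonnegativity of the transform of `Φ` suffices. -/
theorem IsPosDefKernel.upsilonHat_le (hΦ : IsPosDefKernel Φ) (hint : Integrable Φ)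
    {M : ℝ} (hM : 0 < M) (ω : Euc d) : upsilonHat Φ M ω ≤ (fourierHat Φ ω).re := by
  by_cases hω : ‖ω‖ ≤ 2 * M
  · have hG := Real.Gamma_pos_of_pos (s := (d : ℝ) / 2 + 1) (by positivity)
    have h0 := hΦ.fourierHatInf_nonneg hint M
    refine le_trans ?_ (hΦ.fourierHatInf_le hint hω)
    have hpi : 0 < √Real.pi := by positivity
    calc upsilonHat Φ M ω ≤ fourierHatInf Φ M * Real.Gamma ((d : ℝ) / 2 + 1) /
          ((2 : ℝ) ^ d * M ^ d * Real.pi ^ ((d : ℝ) / 2)) *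
            (M ^ d * volume.real (Metric.closedBall (0 : Euc d) 1)) := by
          unfold upsilonHat
          gcongr
          exact convolution_ballIndicator_le hM ω
      _ = fourierHatInf Φ M / 2 ^ d := by
          rw [volume_real_closedBall_one, ← sqrt_pi_pow]
          field_simp
      _ ≤ fourierHatInf Φ M := div_le_self h0 (one_le_pow₀ (by norm_num))
  · rw [upsilonHat, convolution_ballIndicator_eq_zero (not_le.1 hω), mul_zero]
    exact hΦ.fourierHat_re_nonneg hint ω

theorem IsPosDefKernel.upsilonZero_nonneg (hΦ : IsPosDefKernel Φ) (hint : Integrable Φ)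
    {M : ℝ} (hM : 0 < M) : 0 ≤ upsilonZero Φ M := by
  have hG := Real.Gamma_pos_of_pos (s := (d : ℝ) / 2 + 1) (by positivity)
  have h0 := hΦ.fourierHatInf_nonneg hint M
  unfold upsilonZero
  positivity

/-- The quadratic form of `Φ` dominates that of `Υ_M`. -/
theorem IsPosDefKernel.sum_sum_upsilon_le (hΦ : IsPosDefKernel Φ) (hint : Integrable Φ)
    (hhat : Integrable (fourierHat Φ)) {M : ℝ} (hM : 0 < M) {n : ℕ} (y : Fin n → Euc d)
    (α : Fin n → ℝ) :
    ∑ j, ∑ k, α j * α k * (upsilon Φ M (y j - y k)).re ≤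
      ∑ j, ∑ k, α j * α k * Φ (y j - y k) := by
  have hre : Integrable fun ω => (fourierHat Φ ω).re := hhat.re
  have h := sum_sum_integral_mul_cos_mono (integrable_upsilonHat Φ M) hre
    (hΦ.upsilonHat_le hint hM) y α
  have hκ : 0 ≤ (2 * Real.pi) ^ (-(d : ℝ) / 2) := by positivity
  have h' := mul_le_mul_of_nonneg_left h hκ
  simp only [Finset.mul_sum] at h'
  refine Eq.trans_le ?_ (h'.trans_eq ?_)
  · refine Finset.sum_congr rfl fun j _ => Finset.sum_congr rfl fun k _ => ?_
    rw [show upsilon Φ M (y j - y k) = fourierCheck (upsilonHat Φ M) (y j - y k) from rfl,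
      fourierCheck_re (integrable_upsilonHat Φ M)]
    ring
  · refine Finset.sum_congr rfl fun j _ => Finset.sum_congr rfl fun k _ => ?_
    rw [eq_integral_fourierHat_re_mul_cos hΦ.even hΦ.continuous hint hhat (y j - y k)]
    ring

end Inversion

/-! ### Packing estimate for separated points. -/

section Packing

variable {d : ℕ}

/-- In polar coordinates the radial integrand is `r^(d-1) / r^(d+1) = r^(-2)`, with integral `1/s`
over `(s, ∞)`; `d` times the ball volume is the area of the sphere. -/
theorem integrable_and_integral_indicator_inv_norm_pow (hd : 0 < d) {s : ℝ} (hs : 0 < s) :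
    Integrable (fun u : Euc d => (Set.Ioi s).indicator (fun r : ℝ => (r ^ (d + 1))⁻¹) ‖u‖) ∧
    ∫ u : Euc d, (Set.Ioi s).indicator (fun r : ℝ => (r ^ (d + 1))⁻¹) ‖u‖ =
      d * volume.real (Metric.closedBall (0 : Euc d) 1) / s := by
  obtain ⟨m, rfl⟩ : ∃ m, d = m + 1 := ⟨d - 1, by omega⟩
  have hrad : ∀ r : ℝ, r ^ (m + 1 - 1) •
      (Set.Ioi s).indicator (fun r : ℝ => (r ^ (m + 1 + 1))⁻¹) r =
      (Set.Ioi s).indicator (fun r : ℝ => r ^ (-2 : ℝ)) r := by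
    intro r
    by_cases hr : r ∈ Set.Ioi s
    · have hr0 : 0 < r := hs.trans hr
      rw [Set.indicator_of_mem hr, Set.indicator_of_mem hr, Real.rpow_neg hr0.le]
      simp only [Nat.add_sub_cancel, smul_eq_mul]
      norm_cast
      field_simp
      ring
    · rw [Set.indicator_of_notMem hr, Set.indicator_of_notMem hr, smul_zero]
  have hfin : Module.finrank ℝ (Euc (m + 1)) = m + 1 := by simp
  constructor
  · rw [integrable_fun_norm_addHaar volume
      (f := (Set.Ioi s).indicator fun r : ℝ => (r ^ (m + 1 + 1))⁻¹), hfin]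
    simp only [hrad]
    refine Integrable.integrableOn ?_
    rw [integrable_indicator_iff measurableSet_Ioi]
    exact integrableOn_Ioi_rpow_of_lt (by norm_num) hs
  · rw [integral_fun_norm_addHaar volume
      ((Set.Ioi s).indicator fun r : ℝ => (r ^ (m + 1 + 1))⁻¹), hfin]
    simp only [hrad]
    rw [setIntegral_indicator measurableSet_Ioi,
      Set.inter_eq_self_of_subset_right (Set.Ioi_subset_Ioi hs.le),
      integral_Ioi_rpow_of_lt (by norm_num) hs,
      ← Measure.addHaar_real_closedBall_eq_addHaar_real_ball,
      show (-2 : ℝ) + 1 = -1 by norm_num, Real.rpow_neg_one]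
    simp only [nsmul_eq_mul, smul_eq_mul]
    ring

/-- A packing estimate: inverse powers of the distances to the points of a `2q`-separated family,
all at distance at least `2s` from `y j`. -/
theorem sum_inv_norm_sub_pow_le (hd : 0 < d) {n : ℕ} (y : Fin n → Euc d) (j : Fin n) {q s : ℝ}
    (hq : 0 < q) (hqs : q ≤ s) (hsep : ∀ a b, a ≠ b → 2 * q ≤ ‖y a - y b‖)
    (hj : ∀ k, k ≠ j → 2 * s ≤ ‖y j - y k‖) :
    ∑ k ∈ Finset.univ.erase j, (1 / ‖y j - y k‖) ^ (d + 1) ≤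
      (3 / 2) ^ (d + 1) * (d / (q ^ d * s)) := by
  have hs : 0 < s := hq.trans_le hqs
  obtain ⟨hfi, hfv⟩ := integrable_and_integral_indicator_inv_norm_pow hd hs
  set f : Euc d → ℝ := fun u => (Set.Ioi s).indicator (fun r : ℝ => (r ^ (d + 1))⁻¹) ‖u‖ with hf
  have hf0 : ∀ u, 0 ≤ f u := fun u =>
    Set.indicator_nonneg (fun r hr => by
      have : 0 < r := hs.trans hr
      positivity) _
  set V := volume.real (Metric.closedBall (0 : Euc d) 1) with hV
  have hVpos : 0 < V := volume_real_closedBall_one_pos d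
  have hball : ∀ c : Euc d, volume.real (Metric.ball c q) = q ^ d * V := by
    intro c
    have : Nontrivial (Euc d) := Module.nontrivial_of_finrank_pos (R := ℝ) (by simpa using hd)
    rw [← Measure.addHaar_real_closedBall_eq_addHaar_real_ball,
      Measure.addHaar_real_closedBall_center, volume_real_closedBall_euc hq.le]
  have hterm : ∀ k ∈ Finset.univ.erase j, (1 / ‖y j - y k‖) ^ (d + 1) * (q ^ d * V) ≤
      (3 / 2) ^ (d + 1) * ∫ u in Metric.ball (y k - y j) q, f u := by
    intro k hk
    have hr := hj k (Finset.ne_of_mem_erase hk)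
    set r := ‖y j - y k‖ with hrdef
    have hr0 : 0 < r := by linarith
    -- Since `q ≤ s ≤ r/2`, points of this ball satisfy `s ≤ r - q < ‖u‖ ≤ r + q ≤ 3r/2`. Hence the
    -- constant `3/2`.
    have hlow : ∀ u ∈ Metric.ball (y k - y j) q, ((3 / 2 * r) ^ (d + 1))⁻¹ ≤ f u := by
      intro u hu
      rw [mem_ball_iff_norm] at hu
      have hyr : ‖y k - y j‖ = r := norm_sub_rev _ _
      have h1 : s < ‖u‖ := by
        have := norm_sub_norm_le (y k - y j) u
        rw [norm_sub_rev (y k - y j) u] at this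
        linarith
      have h2 : ‖u‖ ≤ 3 / 2 * r := by
        have := norm_sub_norm_le u (y k - y j)
        linarith
      rw [hf]
      simp only [Set.indicator_of_mem (show ‖u‖ ∈ Set.Ioi s from h1)]
      have : 0 < ‖u‖ := hs.trans h1
      gcongr
    have hint := setIntegral_mono_on (μ := volume) (s := Metric.ball (y k - y j) q)
      (integrableOn_const (C := ((3 / 2 * r) ^ (d + 1))⁻¹) measure_ball_lt_top.ne)
      hfi.integrableOn measurableSet_ball hlow
    rw [setIntegral_const, hball, smul_eq_mul] at hint
    calc (1 / r) ^ (d + 1) * (q ^ d * V)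
        = (3 / 2) ^ (d + 1) * (q ^ d * V * ((3 / 2 * r) ^ (d + 1))⁻¹) := by
          rw [mul_pow, div_pow 1 r, one_pow]
          field_simp
      _ ≤ _ := by gcongr
  have hdisj : Set.Pairwise (↑(Finset.univ.erase j) : Set (Fin n))
      (Function.onFun Disjoint fun k => Metric.ball (y k - y j) q) := by
    intro a _ b _ hab
    refine Metric.ball_disjoint_ball ?_
    rw [dist_eq_norm, sub_sub_sub_cancel_right]
    linarith [hsep a b hab]
  -- The balls are disjoint by `2q`-separation, so their integrals add up to at most the full
  -- integral outside radius `s`.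
  have hsum : ∑ k ∈ Finset.univ.erase j, ∫ u in Metric.ball (y k - y j) q, f u ≤ d * V / s := by
    rw [← hfv, ← integral_biUnion_finset _ (fun _ _ => measurableSet_ball) hdisj
      (fun _ _ => hfi.integrableOn)]
    exact setIntegral_le_integral hfi (Eventually.of_forall hf0)
  have htot := (Finset.sum_le_sum hterm).trans_eq (Finset.mul_sum _ _ _).symm
  rw [← Finset.sum_mul] at htot
  have htot' := htot.trans (mul_le_mul_of_nonneg_left hsum (by positivity))
  rw [← le_div_iff₀ (by positivity)] at htot'
  refine htot'.trans_eq ?_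
  field_simp

end Packing

/-! ### Positivity of the separation distances. -/

section Separation

variable {d n : ℕ} {Θ : Matrix (Fin d) (Fin d) ℝ} {x : Fin n → Euc d}

theorem toEuclideanLin_ne_zero (hΘ : Θ.det ≠ 0) {u : Euc d} (hu : u ≠ 0) :
    Matrix.toEuclideanLin Θ u ≠ 0 := by
  intro h
  apply hu
  have h0 : Θ.mulVec u.ofLp = 0 := by
    have := congrArg (fun v : Euc d => v.ofLp) h
    simpa using this
  have := Matrix.eq_zero_of_mulVec_eq_zero hΘ h0
  ext i
  exact congrFun this i

theorem two_mul_localSep_le {j k : Fin n} (hkj : k ≠ j) :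
    2 * localSep Θ x j ≤ mahalanobisDist Θ (x j) (x k) := by
  have := ciInf_le (Set.finite_range fun k : {k : Fin n // k ≠ j} =>
    mahalanobisDist Θ (x j) (x k)).bddBelow ⟨k, hkj⟩
  rw [localSep]
  linarith

theorem localSep_pos (hn : 2 ≤ n) (hΘ : Θ.det ≠ 0) (hx : Function.Injective x) (j : Fin n) :
    0 < localSep Θ x j := by
  have : Nontrivial (Fin n) := Fin.nontrivial_iff_two_le.2 hn
  obtain ⟨k₀, hk₀⟩ := exists_ne j
  have : Nonempty {k : Fin n // k ≠ j} := ⟨⟨k₀, hk₀⟩⟩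
  obtain ⟨k, hk⟩ := exists_eq_ciInf_of_finite (f := fun k : {k : Fin n // k ≠ j} =>
    mahalanobisDist Θ (x j) (x k))
  rw [localSep, ← hk]
  have : 0 < mahalanobisDist Θ (x j) (x k) :=
    norm_pos_iff.2 (toEuclideanLin_ne_zero hΘ (sub_ne_zero.2 (hx.ne k.2.symm)))
  positivity

theorem globalSep_le (j : Fin n) : globalSep Θ x ≤ localSep Θ x j :=
  ciInf_le (Set.finite_range _).bddBelow j

theorem globalSep_pos (hn : 2 ≤ n) (hΘ : Θ.det ≠ 0) (hx : Function.Injective x) :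
    0 < globalSep Θ x := by
  have : Nonempty (Fin n) := ⟨⟨0, by omega⟩⟩
  obtain ⟨j, hj⟩ := exists_eq_ciInf_of_finite (f := localSep Θ x)
  rw [globalSep, ← hj]
  exact localSep_pos hn hΘ hx j

end Separation

/-! ### Diagonal dominance and the eigenvalue bound. -/

section QuadraticForm

/-- A diagonal dominance bound for quadratic forms with unit diagonal. -/
theorem sum_sq_mul_one_sub_le_sum_sum {ι : Type*} [Fintype ι] [DecidableEq ι] {ρ b : ι → ι → ℝ}
    {β : ι → ℝ} (hdiag : ∀ j, ρ j j = 1) (hρ : ∀ j k, k ≠ j → |ρ j k| ≤ b j k)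
    (hb : ∀ j k, b j k = b k j) (hβ : ∀ j, ∑ k ∈ Finset.univ.erase j, b j k ≤ β j)
    (α : ι → ℝ) :
    ∑ j, α j ^ 2 * (1 - β j) ≤ ∑ j, ∑ k, α j * α k * ρ j k := by
  set c : ι → ι → ℝ := fun j k => if k = j then 0 else b j k with hc
  have hcsum : ∀ j, ∑ k, c j k ≤ β j := fun j => by
    refine le_trans (le_of_eq ?_) (hβ j)
    rw [← Finset.add_sum_erase _ _ (Finset.mem_univ j)]
    simp only [hc, if_true, zero_add]
    exact Finset.sum_congr rfl fun k hk => if_neg (Finset.ne_of_mem_erase hk)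
  have hcsymm : ∀ j k, c j k = c k j := fun j k => by
    simp only [hc, hb j k, eq_comm]
  have hpt : ∀ j k, (if k = j then α j ^ 2 else 0) -
      (c j k * α j ^ 2 / 2 + c j k * α k ^ 2 / 2) ≤ α j * α k * ρ j k := by
    intro j k
    by_cases h : k = j
    · subst h
      simp [hc, hdiag, sq]
    · simp only [hc, if_neg h]
      have h1 := hρ j k h
      have h2 : |α j * α k| ≤ (α j ^ 2 + α k ^ 2) / 2 := by
        rw [abs_mul, ← sq_abs (α j), ← sq_abs (α k)]
        nlinarith [sq_nonneg (|α j| - |α k|)]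
      have h3 : |α j * α k * ρ j k| ≤ (α j ^ 2 + α k ^ 2) / 2 * b j k := by
        rw [abs_mul]
        gcongr
      linarith [neg_abs_le (α j * α k * ρ j k)]
  refine le_trans ?_ (Finset.sum_le_sum fun j _ => Finset.sum_le_sum fun k _ => hpt j k)
  -- Symmetry of the bounds moves the weight from `α k` to `α j`, so only row sums are needed.
  have hswap : ∑ j, ∑ k, c j k * α k ^ 2 / 2 = ∑ j, ∑ k, c j k * α j ^ 2 / 2 := by
    rw [Finset.sum_comm]
    simp only [hcsymm]
  simp only [Finset.sum_sub_distrib, Finset.sum_add_distrib, hswap]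
  rw [← Finset.sum_add_distrib, ← Finset.sum_sub_distrib]
  refine Finset.sum_le_sum fun j _ => ?_
  have := mul_le_mul_of_nonneg_right (hcsum j) (sq_nonneg (α j))
  rw [Finset.sum_mul] at this
  rw [← Finset.sum_add_distrib]
  simp only [add_halves, Finset.sum_ite_eq', Finset.mem_univ, if_true]
  linarith

variable {d n : ℕ} {Φ : Euc d → ℝ} {Θ : Matrix (Fin d) (Fin d) ℝ} {x : Fin n → Euc d}

/-- Absorbs the dimension factor `d` of the packing bound: `d/π ≤ (π/18) 2^(d+1)`, which turns the
base `6 = 4 · 3/2` into the 12 of the theorem. -/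
theorem eighteen_mul_le_pi_sq_mul_two_pow (d : ℕ) :
    18 * (d : ℝ) ≤ Real.pi ^ 2 * 2 ^ (d + 1) := by
  have h1 : (d : ℝ) ≤ 2 ^ d := by exact_mod_cast Nat.lt_two_pow_self.le
  have h2 : (9 : ℝ) ≤ Real.pi ^ 2 := by nlinarith [Real.pi_gt_three]
  calc 18 * (d : ℝ) ≤ 9 * 2 ^ (d + 1) := by rw [pow_succ]; linarith
    _ ≤ _ := by gcongr

theorem sum_decay_le_one_sub_sepFactor (hd : 0 < d) (hn : 2 ≤ n) (hΘ : Θ.det ≠ 0)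
    (hx : Function.Injective x) {c : ℝ} (hc : 0 < c) (j : Fin n) :
    ∑ k ∈ Finset.univ.erase j, Real.Gamma ((d : ℝ) / 2 + 1) ^ 2 / Real.pi *
      (4 / (c / globalSep Θ x * mahalanobisDist Θ (x j) (x k))) ^ (d + 1) ≤
      1 - sepFactor Θ x c j := by
  set q := globalSep Θ x
  set s := localSep Θ x j with hs
  have hq : 0 < q := globalSep_pos hn hΘ hx
  have hs0 : 0 < s := localSep_pos hn hΘ hx j
  have hG := Real.Gamma_pos_of_pos (s := (d : ℝ) / 2 + 1) (by positivity)
  have hnorm : ∀ a b, mahalanobisDist Θ (x a) (x b) =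
      ‖Matrix.toEuclideanLin Θ (x a) - Matrix.toEuclideanLin Θ (x b)‖ := fun a b => by
    rw [mahalanobisDist, map_sub]
  have hpack := sum_inv_norm_sub_pow_le hd (fun k => Matrix.toEuclideanLin Θ (x k)) j hq
    (globalSep_le j)
    (fun a b hab => by
      rw [← hnorm]
      linarith [two_mul_localSep_le (Θ := Θ) (x := x) (j := a) (k := b) hab.symm,
        globalSep_le (Θ := Θ) (x := x) a])
    (fun k hk => by rw [← hnorm]; exact two_mul_localSep_le hk)
  simp only [← hnorm] at hpack
  set A := Real.Gamma ((d : ℝ) / 2 + 1) ^ 2 / Real.pi * (4 * (q / c)) ^ (d + 1) with hA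
  have hA0 : 0 < A := by positivity
  calc ∑ k ∈ Finset.univ.erase j, Real.Gamma ((d : ℝ) / 2 + 1) ^ 2 / Real.pi *
        (4 / (c / q * mahalanobisDist Θ (x j) (x k))) ^ (d + 1)
      = A * ∑ k ∈ Finset.univ.erase j, (1 / mahalanobisDist Θ (x j) (x k)) ^ (d + 1) := by
        rw [Finset.mul_sum]
        refine Finset.sum_congr rfl fun k _ => ?_
        rw [hA, mul_assoc, ← mul_pow]
        congr 2
        field_simp
    _ ≤ A * ((3 / 2) ^ (d + 1) * (d / (q ^ d * s))) := by gcongr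
    _ = Real.Gamma ((d : ℝ) / 2 + 1) ^ 2 * (q / s) * (6 / c) ^ (d + 1) * (d / Real.pi) := by
        have h6 : (6 / c) ^ (d + 1) = 4 ^ (d + 1) * (3 / 2) ^ (d + 1) / c ^ (d + 1) := by
          rw [← mul_pow, div_pow]
          norm_num
        rw [hA, h6, mul_pow, div_pow q c, pow_succ q]
        field_simp
    _ ≤ Real.Gamma ((d : ℝ) / 2 + 1) ^ 2 * (q / s) * (6 / c) ^ (d + 1) *
          (Real.pi / 18 * 2 ^ (d + 1)) := by
        gcongr
        rw [div_le_iff₀ Real.pi_pos]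
        linarith [eighteen_mul_le_pi_sq_mul_two_pow d]
    _ = 1 - sepFactor Θ x c j := by
        have h12 : (12 / c) ^ (d + 1) = 2 ^ (d + 1) * (6 / c) ^ (d + 1) := by
          rw [← mul_pow]
          ring_nf
        rw [sepFactor, h12]
        ring

theorem IsPosDefKernel.upsilonZero_mul_sum_le (hn : 2 ≤ n) (hΦ : IsPosDefKernel Φ)
    (hint : Integrable Φ) (hhat : Integrable (fourierHat Φ)) (hΘ : Θ.det ≠ 0)
    (hx : Function.Injective x) {c : ℝ} (hc : 0 < c) (α : Fin n → ℝ) :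
    upsilonZero Φ (c / globalSep Θ x) * ∑ j, α j ^ 2 * sepFactor Θ x c j ≤
      ∑ j, ∑ k, α j * α k * Φ (Matrix.toEuclideanLin Θ (x j - x k)) := by
  -- Two distinct points do not fit in a zero-dimensional space.
  have hd : 0 < d := by
    rcases Nat.eq_zero_or_pos d with rfl | h
    · have : (⟨0, by omega⟩ : Fin n) = ⟨1, by omega⟩ := hx (Subsingleton.elim _ _)
      simp at this
    · exact h
  have hM : 0 < c / globalSep Θ x := div_pos hc (globalSep_pos hn hΘ hx)
  set M := c / globalSep Θ x with hMdef
  set V := volume.real (Metric.closedBall (0 : Euc d) 1) with hV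
  have hV0 : 0 < V := volume_real_closedBall_one_pos d
  -- The normalized values of `Υ_M`, written through the ball transform so that no division by
  -- `Υ_M(0)`, possibly zero, occurs.
  set ρ : Fin n → Fin n → ℝ := fun j k =>
    ((ballTransform (M • (Matrix.toEuclideanLin Θ (x j) - Matrix.toEuclideanLin Θ (x k))) /
      (V : ℂ)) ^ 2).re with hρ
  have hdom : ∑ j, α j ^ 2 * (1 - (1 - sepFactor Θ x c j)) ≤ ∑ j, ∑ k, α j * α k * ρ j k := by
    refine sum_sq_mul_one_sub_le_sum_sum (b := fun j k =>
      Real.Gamma ((d : ℝ) / 2 + 1) ^ 2 / Real.pi *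
        (4 / (M * mahalanobisDist Θ (x j) (x k))) ^ (d + 1)) ?_ ?_ ?_
      (sum_decay_le_one_sub_sepFactor hd hn hΘ hx hc) α
    · intro j
      have : (V : ℂ) ≠ 0 := by exact_mod_cast hV0.ne'
      simp [hρ, ballTransform_zero, ← hV, div_self this]
    · intro j k hk
      have hne : M • (Matrix.toEuclideanLin Θ (x j) - Matrix.toEuclideanLin Θ (x k)) ≠ 0 := by
        rw [← map_sub]
        exact smul_ne_zero hM.ne'
          (toEuclideanLin_ne_zero hΘ (sub_ne_zero.2 (hx.ne hk.symm)))
      have h := norm_ballTransform_sq_le hd hne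
      rw [norm_smul, Real.norm_of_nonneg hM.le, ← map_sub, ← hV, mul_comm (V ^ 2),
        ← div_le_iff₀ (by positivity)] at h
      refine (Complex.abs_re_le_norm _).trans ?_
      rw [norm_pow, norm_div, Complex.norm_real, Real.norm_of_nonneg hV0.le, div_pow, ← map_sub]
      exact h
    · intro j k
      simp only [mahalanobisDist]
      rw [← neg_sub (x k) (x j), map_neg, norm_neg]
  simp only [sub_sub_cancel] at hdom
  refine (mul_le_mul_of_nonneg_left hdom (hΦ.upsilonZero_nonneg hint hM)).trans ?_
  refine Eq.trans_le ?_ ((hΦ.sum_sum_upsilon_le hint hhat hM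
    (fun k => Matrix.toEuclideanLin Θ (x k)) α).trans_eq ?_)
  · rw [Finset.mul_sum]
    refine Finset.sum_congr rfl fun j _ => ?_
    rw [Finset.mul_sum]
    refine Finset.sum_congr rfl fun k _ => ?_
    rw [upsilon_eq Φ hM, Complex.re_ofReal_mul]
    ring
  · simp only [map_sub]

/-- A diagonal lower bound for the quadratic form of a symmetric matrix bounds its smallest
eigenvalue. -/
theorem Matrix.IsHermitian.exists_isLeast_spectrum_ge {ι : Type*} [Fintype ι] [DecidableEq ι]
    [Nonempty ι] {K : Matrix ι ι ℝ} (hK : K.IsHermitian) {m : ℝ}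
    (h : ∀ α : ι → ℝ, m * ∑ j, α j ^ 2 ≤ ∑ j, ∑ k, α j * α k * K j k) :
    ∃ lam : ℝ, IsLeast (spectrum ℝ K) lam ∧ m ≤ lam := by
  obtain ⟨j₀, hj₀⟩ := Finite.exists_min hK.eigenvalues
  refine ⟨hK.eigenvalues j₀, ?_, ?_⟩
  · rw [hK.spectrum_real_eq_range_eigenvalues]
    exact ⟨⟨j₀, rfl⟩, by rintro _ ⟨j, rfl⟩; exact hj₀ j⟩
  -- Evaluating the form at a unit eigenvector gives exactly the smallest eigenvalue.
  · set v := hK.eigenvectorBasis j₀ with hv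
    have hone : ∑ j, v j ^ 2 = 1 := by
      have := hK.eigenvectorBasis.norm_eq_one j₀
      rw [← hv] at this
      have h2 := EuclideanSpace.real_norm_sq_eq v
      rw [this] at h2
      rw [← h2]
      norm_num
    have hev := hK.mulVec_eigenvectorBasis j₀
    have hq : ∑ j, ∑ k, v j * v k * K j k = hK.eigenvalues j₀ := by
      calc ∑ j, ∑ k, v j * v k * K j k = ∑ j, v j * (K.mulVec v.ofLp) j := by
            refine Finset.sum_congr rfl fun j _ => ?_
            rw [Matrix.mulVec, dotProduct, Finset.mul_sum]
            exact Finset.sum_congr rfl fun k _ => by ring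
        _ = ∑ j, hK.eigenvalues j₀ * v j ^ 2 := by
            rw [hv, hev]
            refine Finset.sum_congr rfl fun j _ => ?_
            simp only [Pi.smul_apply, smul_eq_mul]
            ring
        _ = hK.eigenvalues j₀ := by rw [← Finset.mul_sum, hone, mul_one]
    have := h v.ofLp
    rwa [hone, mul_one, hq] at this

end QuadraticForm

theorem mainTheorem1 {d n : ℕ} (hn : 2 ≤ n) (Φ : Euc d → ℝ) (hΦ : IsPosDefKernel Φ)
    (hΦ_int : Integrable Φ) (hΦ_hat : Integrable (fourierHat Φ))
    (Θ : Matrix (Fin d) (Fin d) ℝ) (hΘ : Θ.det ≠ 0)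
    (x : Fin n → Euc d) (hx : Function.Injective x) (c : ℝ) (hc : 0 < c) :
    (∀ M : ℝ, 0 < M → Tendsto (upsilon Φ M) (𝓝[≠] 0) (𝓝 (upsilonZero Φ M : ℂ))) ∧
    (∀ α : Fin n → ℝ,
      upsilonZero Φ (c / globalSep Θ x) * ∑ j, α j ^ 2 * sepFactor Θ x c j ≤
        ∑ j, ∑ k, α j * α k * Φ (Matrix.toEuclideanLin Θ (x j - x k))) ∧
    (∃ lam : ℝ, IsLeast (spectrum ℝ (kernelMatrix Φ Θ x)) lam ∧
      (⨅ j, upsilonZero Φ (c / globalSep Θ x) * sepFactor Θ x c j) ≤ lam) := by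
  have hbound := fun α => hΦ.upsilonZero_mul_sum_le hn hΦ_int hΦ_hat hΘ hx hc α
  refine ⟨fun M hM => tendsto_upsilon Φ hM, hbound, ?_⟩
  have : Nonempty (Fin n) := ⟨⟨0, by omega⟩⟩
  have hK : (kernelMatrix Φ Θ x).IsHermitian := by
    ext j k
    simp only [kernelMatrix, Matrix.conjTranspose_apply, Matrix.of_apply, star_trivial]
    rw [← neg_sub (x j) (x k), map_neg, hΦ.even]
  refine hK.exists_isLeast_spectrum_ge fun α => le_trans ?_ (hbound α)
  rw [Finset.mul_sum, Finset.mul_sum]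
  refine Finset.sum_le_sum fun j _ => ?_
  have := mul_le_mul_of_nonneg_right (ciInf_le (Set.finite_range fun j =>
    upsilonZero Φ (c / globalSep Θ x) * sepFactor Θ x c j).bddBelow j) (sq_nonneg (α j))
  linarith
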